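/- Let $M$ be a connected smooth manifold (Hausdorff and second countable) of dimension $m$, let $g$ be a smooth Riemannian metric on $M$ with Levi-Civita connection $\nabla$, and let $\Sigma\subseteq TM$ be a smooth distribution of rank $k\le m$, equipped with the sub-Riemannian metric $g_c=g|_\Sigma$. Let $\mathcal P:TM\to\Sigma$ be the $g$-orthogonal projection, and let $D_XY=\mathcal P(\nabla_XY)$, for smooth sections $X,Y$ of $\Sigma$, be the horizontal connection. A nonholonomic geodesic is a curve $\gamma$, defined on an interval, with $\dot\gamma\in\Sigma_\gamma$ and $D_{\dot\gamma}\dot\gamma=0$. The sub-Riemannian manifold $(M,\Sigma,g_c)$ is nonholonomically complete if every nonholonomic geodesic extends to a nonholonomic geodesic defined on the whole real line. A function $f:M\to\mathbb R$ is n-convex if its restriction $f\circ\gamma$ to every nonholonomic geodesic $\gamma$ is a convex function on the interval where $\gamma$ is defined. For $p\in M$ and $i\ge 1$ let $\Sigma_i(p)\subseteq T_pM$ be the span of the values at $p$ of all iterated commutators of order at most $i$ of smooth sections of $\Sigma$. The distribution $\Sigma$ is regular if for every $p\in M$ there is an integer $l$ with $\Sigma_l(p)=T_pM$ such that, for all $i\le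 l$, the dimension of $\Sigma_i(q)$ is constant for $q$ in a neighbourhood of $p$. Suppose that $(M,\Sigma,g_c)$ is nonholonomically complete and that $\Sigma$ is regular. Then every n-convex function $f:M\to\mathbb R$ that is bounded above is constant. -/

import Mathlib

open Bundle Manifold
open scoped ContDiff Topology

namespace SubRiem

set_option linter.unusedSectionVars false

noncomputable section LeviCivita

variable {E : Type*} [NormedAddCommGroup E] [NormedSpace ℝ E] [FiniteDimensional ℝ E]
  {H : Type*} [TopologicalSpace H] (I : ModelWithCorners ℝ E H)
  {M : Type*} [TopologicalSpace M] [ChartedSpace H M] [IsManifold I ∞ M]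
  [RiemannianBundle (fun x : M => TangentSpace I x)]
  [IsContMDiffRiemannianBundle I ∞ E (fun x : M => TangentSpace I x)]

/-- The right-hand side of the Koszul formula `2 g(∇_X Y, Z) = …` for the Riemannian metric
`g = inner ℝ` on the tangent bundle:
`X g(Y,Z) + Y g(X,Z) - Z g(X,Y) + g([X,Y],Z) - g([X,Z],Y) - g([Y,Z],X)`. -/
def koszul (X Y Z : Π x : M, TangentSpace I x) (x : M) : ℝ :=
  mvfderiv I (fun y => inner ℝ (Y y) (Z y)) x (X x)
    + mvfderiv I (fun y => inner ℝ (X y) (Z y)) x (Y x)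
    - mvfderiv I (fun y => inner ℝ (X y) (Y y)) x (Z x)
    + inner ℝ (VectorField.mlieBracket I X Y x) (Z x)
    - inner ℝ (VectorField.mlieBracket I X Z x) (Y x)
    - inner ℝ (VectorField.mlieBracket I Y Z x) (X x)

theorem mdiffAt_inner {X Y : Π x : M, TangentSpace I x} {x : M}
    (hX : MDiffAt (T% X) x) (hY : MDiffAt (T% Y) x) :
    MDiffAt (fun y => inner ℝ (X y) (Y y)) x :=
  haveI : IsContMDiffRiemannianBundle I 1 E (fun x : M => TangentSpace I x) :=
    IsContMDiffRiemannianBundle.of_le (n := ∞) (by exact_mod_cast le_top)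
  MDifferentiableAt.inner_bundle (IB := I) (F := E) (E := fun x : M => TangentSpace I x) hX hY

theorem koszul_tensorial_left {Y Z : Π x : M, TangentSpace I x} {x : M}
    (hY : MDiffAt (T% Y) x) (hZ : MDiffAt (T% Z) x) :
    TensorialAt I E (fun X => koszul I X Y Z x) x where
  smul {f X} hf hX := by
    have e1 : (fun y => inner ℝ ((f • X) y) (Z y)) = f * (fun y => inner ℝ (X y) (Z y)) := by
      ext y; simp [inner_smul_left]
    have e2 : (fun y => inner ℝ ((f • X) y) (Y y)) = f * (fun y => inner ℝ (X y) (Y y)) := by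
      ext y; simp [inner_smul_left]
    unfold koszul
    rw [e1, e2, mvfderiv_mul hf (mdiffAt_inner I hX hZ), mvfderiv_mul hf (mdiffAt_inner I hX hY),
      VectorField.mlieBracket_smul_left hf hX, VectorField.mlieBracket_smul_left hf hX]
    simp [inner_smul_left, inner_smul_right, inner_add_left]
    ring
  add {X X'} hX hX' := by
    have e1 : (fun y => inner ℝ ((X + X') y) (Z y)) =
      (fun y => inner ℝ (X y) (Z y)) + (fun y => inner ℝ (X' y) (Z y)) := by
      ext y; simp [inner_add_left]
    have e2 : (fun y => inner ℝ ((X + X') y) (Y y)) =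
      (fun y => inner ℝ (X y) (Y y)) + (fun y => inner ℝ (X' y) (Y y)) := by
      ext y; simp [inner_add_left]
    unfold koszul
    rw [e1, e2, mvfderiv_add (mdiffAt_inner I hX hZ) (mdiffAt_inner I hX' hZ),
      mvfderiv_add (mdiffAt_inner I hX hY) (mdiffAt_inner I hX' hY),
      VectorField.mlieBracket_add_left hX hX', VectorField.mlieBracket_add_left hX hX']
    simp [inner_add_left, inner_add_right]
    ring

theorem koszul_tensorial_right {X Y : Π x : M, TangentSpace I x} {x : M}
    (hX : MDiffAt (T% X) x) (hY : MDiffAt (T% Y) x) :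
    TensorialAt I E (fun Z => koszul I X Y Z x) x where
  smul {f Z} hf hZ := by
    have e1 : (fun y => inner ℝ (Y y) ((f • Z) y)) = f * (fun y => inner ℝ (Y y) (Z y)) := by
      ext y; simp [inner_smul_right]
    have e2 : (fun y => inner ℝ (X y) ((f • Z) y)) = f * (fun y => inner ℝ (X y) (Z y)) := by
      ext y; simp [inner_smul_right]
    unfold koszul
    rw [e1, e2, mvfderiv_mul hf (mdiffAt_inner I hY hZ), mvfderiv_mul hf (mdiffAt_inner I hX hZ),
      VectorField.mlieBracket_smul_right hf hZ, VectorField.mlieBracket_smul_right hf hZ]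
    simp [inner_smul_left, inner_smul_right, inner_add_left, real_inner_comm (X x) (Z x),
      real_inner_comm (Y x) (Z x)]
    ring
  add {Z Z'} hZ hZ' := by
    have e1 : (fun y => inner ℝ (Y y) ((Z + Z') y)) =
      (fun y => inner ℝ (Y y) (Z y)) + (fun y => inner ℝ (Y y) (Z' y)) := by
      ext y; simp [inner_add_right]
    have e2 : (fun y => inner ℝ (X y) ((Z + Z') y)) =
      (fun y => inner ℝ (X y) (Z y)) + (fun y => inner ℝ (X y) (Z' y)) := by
      ext y; simp [inner_add_right]
    unfold koszul
    rw [e1, e2, mvfderiv_add (mdiffAt_inner I hY hZ) (mdiffAt_inner I hY hZ'),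
      mvfderiv_add (mdiffAt_inner I hX hZ) (mdiffAt_inner I hX hZ'),
      VectorField.mlieBracket_add_right hZ hZ', VectorField.mlieBracket_add_right hZ hZ']
    simp [inner_add_left, inner_add_right]
    ring

/-- For `Y` differentiable at `x`, the bilinear form `(X x, Z x) ↦ koszul X Y Z x`. -/
def koszulForm (Y : Π x : M, TangentSpace I x) {x : M} (hY : MDiffAt (T% Y) x) :
    TangentSpace I x →L[ℝ] TangentSpace I x →L[ℝ] ℝ :=
  TensorialAt.mkHom₂ (I := I) (F := E) (F' := E) (fun X Z => koszul I X Y Z x) x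
    (fun _ hZ => koszul_tensorial_left I hY hZ) (fun _ hX => koszul_tensorial_right I hX hY)

instance tangentFiniteDimensional (x : M) : FiniteDimensional ℝ (TangentSpace I x) :=
  inferInstanceAs (FiniteDimensional ℝ E)

instance tangentCompleteSpace (x : M) : CompleteSpace (TangentSpace I x) :=
  FiniteDimensional.complete ℝ _

theorem koszulForm_apply {X Y Z : Π x : M, TangentSpace I x} {x : M}
    (hX : MDiffAt (T% X) x) (hY : MDiffAt (T% Y) x) (hZ : MDiffAt (T% Z) x) :
    koszulForm I Y hY (X x) (Z x) = koszul I X Y Z x :=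
  TensorialAt.mkHom₂_apply _ _ hX hZ

open Classical in
/-- `∇Y` at `x`, as the map `v ↦ ∇_v Y`: the vector `∇_v Y` is determined by the Koszul formula
`2 g(∇_X Y, Z) = koszul X Y Z` through the Riesz isomorphism of `(T_x M, g)`.
(The junk value `0` is used where `Y` is not differentiable.) -/
def leviCivitaFun (Y : Π x : M, TangentSpace I x) (x : M) :
    TangentSpace I x →L[ℝ] TangentSpace I x :=
  if hY : MDiffAt (T% Y) x then
    LinearMap.toContinuousLinearMap
      { toFun := fun v =>
          (InnerProductSpace.toDual ℝ (TangentSpace I x)).symm ((2⁻¹ : ℝ) • koszulForm I Y hY v)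
        map_add' := fun v w => by simp
        map_smul' := fun c v => by
          have h : koszulForm I Y hY (c • v) = c • koszulForm I Y hY v := map_smul _ _ _
          simp [h, smul_comm (2⁻¹ : ℝ) c] }
  else 0

theorem inner_leviCivitaFun {X Y Z : Π x : M, TangentSpace I x} {x : M}
    (hX : MDiffAt (T% X) x) (hY : MDiffAt (T% Y) x) (hZ : MDiffAt (T% Z) x) :
    inner ℝ (leviCivitaFun I Y x (X x)) (Z x) = 2⁻¹ * koszul I X Y Z x := by
  have h : inner ℝ ((InnerProductSpace.toDual ℝ (TangentSpace I x)).symm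
      ((2⁻¹ : ℝ) • koszulForm I Y hY (X x))) (Z x) = 2⁻¹ * koszul I X Y Z x := by
    rw [InnerProductSpace.toDual_symm_apply, ← koszulForm_apply I hX hY hZ]
    rfl
  rw [← h, leviCivitaFun, dif_pos hY]
  rfl

theorem ext_of_inner {x : M} {A B : TangentSpace I x →L[ℝ] TangentSpace I x}
    (h : ∀ X Z : Π x : M, TangentSpace I x, MDiffAt (T% X) x → MDiffAt (T% Z) x →
      inner ℝ (A (X x)) (Z x) = inner ℝ (B (X x)) (Z x)) : A = B := by
  ext v
  refine ext_inner_right ℝ fun w => ?_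
  simpa using h (FiberBundle.extend E v) (FiberBundle.extend E w)
    (FiberBundle.mdifferentiableAt_extend ..) (FiberBundle.mdifferentiableAt_extend ..)

variable (M) in
/-- The Levi-Civita connection of the Riemannian metric; `leviCivita I M Y x v` is `∇_v Y`. -/
def leviCivita : CovariantDerivative I E (TangentSpace I : M → Type _) where
  toFun := leviCivitaFun I
  isCovariantDerivativeOnUniv :=
    { add := by
        intro Y Y' x hY hY' _
        refine ext_of_inner I fun X Z hX hZ => ?_
        have hYY : MDiffAt (T% (Y + Y')) x := mdifferentiableAt_add_section hY hY'
        have e1 : (fun y => inner ℝ ((Y + Y') y) (Z y)) =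
            (fun y => inner ℝ (Y y) (Z y)) + (fun y => inner ℝ (Y' y) (Z y)) := by
          ext y; simp [inner_add_left]
        have e2 : (fun y => inner ℝ (X y) ((Y + Y') y)) =
            (fun y => inner ℝ (X y) (Y y)) + (fun y => inner ℝ (X y) (Y' y)) := by
          ext y; simp [inner_add_right]
        rw [inner_leviCivitaFun I hX hYY hZ, add_apply, inner_add_left,
          inner_leviCivitaFun I hX hY hZ, inner_leviCivitaFun I hX hY' hZ]
        unfold koszul
        rw [e1, e2, mvfderiv_add (mdiffAt_inner I hY hZ) (mdiffAt_inner I hY' hZ),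
          mvfderiv_add (mdiffAt_inner I hX hY) (mdiffAt_inner I hX hY'),
          VectorField.mlieBracket_add_left hY hY', VectorField.mlieBracket_add_right hY hY']
        simp [inner_add_left, inner_add_right]
        ring
      leibniz := by
        intro Y f x hY hf _
        refine ext_of_inner I fun X Z hX hZ => ?_
        have hfY : MDiffAt (T% (f • Y)) x := hf.smul_section hY
        have e1 : (fun y => inner ℝ ((f • Y) y) (Z y)) = f * (fun y => inner ℝ (Y y) (Z y)) := by
          ext y; simp [inner_smul_left]
        have e2 : (fun y => inner ℝ (X y) ((f • Y) y)) = f * (fun y => inner ℝ (X y) (Y y)) := by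
          ext y; simp [inner_smul_right]
        rw [inner_leviCivitaFun I hX hfY hZ, add_apply, inner_add_left,
          smul_apply, inner_smul_left, inner_leviCivitaFun I hX hY hZ]
        unfold koszul
        rw [e1, e2, mvfderiv_mul hf (mdiffAt_inner I hY hZ),
          mvfderiv_mul hf (mdiffAt_inner I hX hY),
          VectorField.mlieBracket_smul_left hf hY, VectorField.mlieBracket_smul_right hf hY]
        simp [inner_smul_left, inner_smul_right, inner_add_left, real_inner_comm (X x) (Y x)]
        ring }

/-- The Levi-Civita connection is torsion free. -/
theorem leviCivita_torsion : (leviCivita I M).torsion = 0 := by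
  rw [CovariantDerivative.torsion_eq_zero_iff]
  intro X Y x hX hY
  refine ext_inner_right ℝ fun w => ?_
  have hZ : MDiffAt (T% (FiberBundle.extend E w)) x := FiberBundle.mdifferentiableAt_extend ..
  have h1 := inner_leviCivitaFun I hX hY hZ
  have h2 := inner_leviCivitaFun I hY hX hZ
  rw [FiberBundle.extend_apply_self] at h1 h2
  rw [inner_sub_left]
  change inner ℝ (leviCivitaFun I Y x (X x)) w - inner ℝ (leviCivitaFun I X x (Y x)) w = _
  rw [h1, h2]
  simp only [koszul, VectorField.mlieBracket_swap_apply (V := Y) (W := X), inner_neg_left,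
    real_inner_comm, FiberBundle.extend_apply_self]
  ring

/-- The Levi-Civita connection is compatible with the metric. -/
theorem leviCivita_isMetricCompatible : 
    CovariantDerivative.IsMetricCompatible (V := fun x : M => TangentSpace I x) (leviCivita I M) := by
  rw [CovariantDerivative.isMetricCompatible_iff]
  intro x X Y Z hX hY hZ
  have h1 := inner_leviCivitaFun I hX hY hZ
  have h2 := inner_leviCivitaFun I hX hZ hY
  rw [real_inner_comm] at h2
  change _ = inner ℝ (leviCivitaFun I Y x (X x)) (Z x) +
    inner ℝ (Y x) (leviCivitaFun I Z x (X x))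
  have e (A B : Π x : M, TangentSpace I x) :
      (fun y => inner ℝ (A y) (B y)) = fun y => inner ℝ (B y) (A y) := by
    ext y; exact real_inner_comm _ _
  rw [h1, h2]
  simp only [koszul, VectorField.mlieBracket_swap_apply (V := Z) (W := Y), inner_neg_left, e Z Y]
  ring

end LeviCivita
noncomputable section SubRiemannian

variable {E : Type*} [NormedAddCommGroup E] [NormedSpace ℝ E]
  {H : Type*} [TopologicalSpace H] (I : ModelWithCorners ℝ E H)
  {M : Type*} [TopologicalSpace M] [ChartedSpace H M]

/-- The velocity `γ'(t)` of a curve `γ`. -/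
def velocity (γ : ℝ → M) (t : ℝ) :
    TangentSpace I (γ t) :=
  mfderiv 𝓘(ℝ, ℝ) I γ t (1 : ℝ)

/-- `X 0, …, X (k-1)` is a smooth frame on `U` of the field of subspaces `S x ⊆ T_x M`. -/
structure IsHorizontalFrameOn [IsManifold I ∞ M] {k : ℕ}
    (S : Π x : M, Submodule ℝ (TangentSpace I x))
    (X : Fin k → Π x : M, TangentSpace I x) (U : Set M) : Prop where
  contMDiffOn : ∀ i, CMDiff[U] ∞ (T% (X i))
  linearIndependent : ∀ x ∈ U, LinearIndependent ℝ (fun i => X i x)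
  span_eq : ∀ x ∈ U, Submodule.span ℝ (Set.range fun i => X i x) = S x

variable (M) in
/-- A smooth distribution (horizontal bundle) `Σ ⊆ TM` of rank `k`. -/
structure HorizontalBundle [IsManifold I ∞ M] (k : ℕ) where
  fiber : Π x : M, Submodule ℝ (TangentSpace I x)
  exists_frame : ∀ p : M, ∃ (U : Set M) (X : Fin k → Π x : M, TangentSpace I x),
    IsOpen U ∧ p ∈ U ∧ IsHorizontalFrameOn I fiber X U

namespace HorizontalBundle

variable {I} [IsManifold I ∞ M] {k : ℕ} (S : HorizontalBundle I M k)

/-- Smooth horizontal vector fields on `M`, i.e. the elements of `Γ(Σ)`. -/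
def IsSection (X : Π x : M, TangentSpace I x) : Prop :=
  CMDiff ∞ (T% X) ∧ ∀ x, X x ∈ S.fiber x

/-- `S.IsCommutator i X`: the vector field `X` is an iterated commutator
`[X₁, [X₂, …, [X_{i-1}, X_i]…]]` of order `i` of smooth horizontal vector fields. -/
inductive IsCommutator : ℕ → (Π x : M, TangentSpace I x) → Prop
  | of_section {X : Π x : M, TangentSpace I x} (hX : S.IsSection X) : IsCommutator 1 X
  | bracket {i : ℕ} {X Y : Π x : M, TangentSpace I x} (hX : S.IsSection X)
      (hY : IsCommutator i Y) : IsCommutator (i + 1) (VectorField.mlieBracket I X Y)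

/-- `Σ_i(p) ⊆ T_p M`: the span of the values at `p` of all commutators of order `≤ i` of
horizontal vector fields. -/
def flag (i : ℕ) (p : M) : Submodule ℝ (TangentSpace I p) :=
  Submodule.span ℝ {v | ∃ j ≤ i, ∃ X : Π x : M, TangentSpace I x, S.IsCommutator j X ∧ X p = v}

/-- `Σ` is regular: at every point `p` it is bracket generating, `Σ_l(p) = T_p M` for some `l`,
and moreover `Σ_i` has constant dimension near `p` for every `i ≤ l`. -/
def IsRegular : Prop :=
  ∀ p : M, ∃ l : ℕ, S.flag l p = ⊤ ∧
    ∀ i ≤ l, ∀ᶠ q in 𝓝 p, Module.finrank ℝ (S.flag i q) = Module.finrank ℝ (S.flag i p)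

variable [FiniteDimensional ℝ E] [RiemannianBundle (fun x : M => TangentSpace I x)]
  [IsContMDiffRiemannianBundle I ∞ E (fun x : M => TangentSpace I x)]

/-- The horizontal connection `D = P ∘ ∇`, with `∇` the Levi-Civita connection of `g` and
`P : T_x M → Σ_x` the `g`-orthogonal projection; `S.horizontalConnection Y x v` is `D_v Y`. -/
def horizontalConnection (Y : Π x : M, TangentSpace I x) (x : M) :
    TangentSpace I x →L[ℝ] TangentSpace I x :=
  (S.fiber x).starProjection ∘L leviCivita I M Y x

/-- The horizontal vector field `Y` along the curve `γ` has covariant derivative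
`(D/dt) Y = W` at time `t`: in a local frame `X_1, …, X_k` of `Σ` around `γ t`, writing
`Y = ∑ y_j X_j` near `t`, one has `W = ∑ (y_j'(t) X_j + y_j(t) D_{γ'(t)} X_j)`.
By the Leibniz rule this does not depend on the frame. -/
def HasCovariantDerivAlong (γ : ℝ → M) (Y : Π t : ℝ, TangentSpace I (γ t)) (t : ℝ)
    (W : TangentSpace I (γ t)) : Prop :=
  ∃ (U : Set M) (X : Fin k → Π x : M, TangentSpace I x) (y : Fin k → ℝ → ℝ) (y' : Fin k → ℝ),
    IsOpen U ∧ γ t ∈ U ∧ IsHorizontalFrameOn I S.fiber X U ∧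
    (∀ᶠ s in 𝓝 t, Y s = ∑ j, y j s • X j (γ s)) ∧
    (∀ j, HasDerivAt (y j) (y' j) t) ∧
    W = ∑ j, (y' j • X j (γ t) + y j t • S.horizontalConnection (X j) (γ t) (velocity I γ t))

/-- `γ` restricted to the open interval `J` is a nonholonomic geodesic: it is a horizontal curve
with `D_{γ'} γ' = 0`. Since this is a second order differential equation with smooth
coefficients, such a `γ` is automatically smooth on `J`. -/
structure IsNonholonomicGeodesicOn (γ : ℝ → M) (J : Set ℝ) : Prop where
  differentiable : ∀ t ∈ J, MDifferentiableAt 𝓘(ℝ, ℝ) I γ t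
  horizontal : ∀ t ∈ J, velocity I γ t ∈ S.fiber (γ t)
  equation : ∀ t ∈ J, S.HasCovariantDerivAlong γ (velocity I γ) t 0

/-- Nonholonomic completeness: every nonholonomic geodesic, defined on some open interval `J`,
extends to a nonholonomic geodesic defined on the whole real line. -/
def IsNonholonomicallyComplete : Prop :=
  ∀ (J : Set ℝ) (γ : ℝ → M), IsOpen J → J.OrdConnected → S.IsNonholonomicGeodesicOn γ J →
    ∃ η : ℝ → M, S.IsNonholonomicGeodesicOn η Set.univ ∧ Set.EqOn η γ J

/-- `f : M → ℝ` is n-convex: its restriction to every nonholonomic geodesic is convex. -/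
def IsNConvex (f : M → ℝ) : Prop :=
  ∀ (J : Set ℝ) (γ : ℝ → M), IsOpen J → J.OrdConnected → S.IsNonholonomicGeodesicOn γ J →
    ConvexOn ℝ J (f ∘ γ)

end HorizontalBundle

end SubRiemannian

end SubRiem

namespace SubRiem

set_option linter.unusedSectionVars false

universe u v

section Nemytskii

variable {K : Type*} [TopologicalSpace K] [CompactSpace K]
  {E F : Type*} [NormedAddCommGroup E] [NormedSpace ℝ E] [NormedAddCommGroup F] [NormedSpace ℝ F]

set_option synthInstance.maxHeartbeats 200000 in
/-- Pointwise application of a continuous family of linear maps to a continuous map. -/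
noncomputable def pointwiseApply (K E F : Type*) [TopologicalSpace K] [CompactSpace K]
    [NormedAddCommGroup E] [NormedSpace ℝ E] [NormedAddCommGroup F] [NormedSpace ℝ F] :
    C(K, E →L[ℝ] F) →L[ℝ] C(K, E) →L[ℝ] C(K, F) :=
  LinearMap.mkContinuous₂
    (LinearMap.mk₂ ℝ (fun (A : C(K, E →L[ℝ] F)) (b : C(K, E)) => (⟨fun s => A s (b s), by fun_prop⟩ : C(K, F)))
      (fun A A' b => by ext; simp) (fun c A b => by ext; simp)
      (fun A b b' => by ext; simp) (fun c A b => by ext; simp)) 1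
    (fun A b => by
      rw [one_mul]
      refine (ContinuousMap.norm_le _ (by positivity)).2 fun s => ?_
      exact (A s).le_of_opNorm_le_of_le (A.norm_coe_le_norm s) (b.norm_coe_le_norm s))

@[simp] theorem pointwiseApply_apply (A : C(K, E →L[ℝ] F)) (b : C(K, E)) (s : K) :
    pointwiseApply K E F A b s = A s (b s) := rfl

theorem hasFDerivAt_postcomp {w : E → F} (hw : ContDiff ℝ 1 w) (a : C(K, E)) :
    HasFDerivAt (fun a : C(K, E) => (⟨w, hw.continuous⟩ : C(E, F)).comp a)
      (pointwiseApply K E F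
        ((⟨fderiv ℝ w, hw.continuous_fderiv one_ne_zero⟩ : C(E, E →L[ℝ] F)).comp a)) a := by
  rw [hasFDerivAt_iff_isLittleO_nhds_zero, Asymptotics.isLittleO_iff]
  intro c hc
  have key : ∀ᶠ h : E in 𝓝 0, ∀ s ∈ (Set.univ : Set K),
      ‖w (a s + h) - w (a s) - fderiv ℝ w (a s) h‖ ≤ c * ‖h‖ := by
    refine IsCompact.eventually_forall_of_forall_eventually isCompact_univ fun s _ => ?_
    have h1 := (hw.contDiffAt (x := a s)).hasStrictFDerivAt one_ne_zero
    have h2 := (hasStrictFDerivAt_iff_isLittleO.1 h1).def (half_pos hc)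
    have h3 : Filter.Tendsto (fun z : E × K => (a z.2 + z.1, a z.2)) (𝓝 (0, s))
        (𝓝 (a s, a s)) := by
      have : Continuous (fun z : E × K => (a z.2 + z.1, a z.2)) := by fun_prop
      simpa using this.tendsto (0, s)
    have h4 : ∀ᶠ z : E × K in 𝓝 (0, s), ‖fderiv ℝ w (a z.2) - fderiv ℝ w (a s)‖ < c / 2 := by
      have : Continuous (fun z : E × K => ‖fderiv ℝ w (a z.2) - fderiv ℝ w (a s)‖) := by
        have := hw.continuous_fderiv one_ne_zero
        fun_prop
      have := this.tendsto (0, s)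
      simp only [sub_self, norm_zero] at this
      exact this.eventually (gt_mem_nhds (half_pos hc))
    filter_upwards [h3.eventually h2, h4] with z hz hz'
    have e : w (a z.2 + z.1) - w (a z.2) - fderiv ℝ w (a z.2) z.1 =
        (w (a z.2 + z.1) - w (a z.2) - fderiv ℝ w (a s) (a z.2 + z.1 - a z.2))
          - (fderiv ℝ w (a z.2) - fderiv ℝ w (a s)) z.1 := by simp
    rw [e]
    have h5 := (fderiv ℝ w (a z.2) - fderiv ℝ w (a s)).le_of_opNorm_le hz'.le z.1
    simp only [add_sub_cancel_left] at hz ⊢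
    calc _ ≤ _ := norm_sub_le _ _
      _ ≤ c / 2 * ‖z.1‖ + c / 2 * ‖z.1‖ := add_le_add hz h5
      _ = _ := by ring
  obtain ⟨δ, hδ, H⟩ := Metric.eventually_nhds_iff.1 key
  filter_upwards [Metric.ball_mem_nhds (0 : C(K, E)) hδ] with h hh
  refine (ContinuousMap.norm_le _ (by positivity)).2 fun s => ?_
  have hs : ‖h s‖ ≤ ‖h‖ := h.norm_coe_le_norm s
  have := H (y := h s) (by simpa using lt_of_le_of_lt hs (by simpa using hh)) s (Set.mem_univ _)
  refine le_trans ?_ (this.trans (by gcongr))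
  simp

set_option synthInstance.maxHeartbeats 200000 in
theorem contDiff_postcomp {E : Type u} {F : Type (max u v)} [NormedAddCommGroup E] [NormedSpace ℝ E]
    [NormedAddCommGroup F] [NormedSpace ℝ F] (n : ℕ) {w : E → F} (hw : ContDiff ℝ n w) :
    ContDiff ℝ n (fun a : C(K, E) => (⟨w, hw.continuous⟩ : C(E, F)).comp a) := by
  induction n generalizing F with
  | zero => exact contDiff_zero.2 (ContinuousMap.continuous_postcomp _)
  | succ n ih =>
    have hw' : ContDiff ℝ ((n : WithTop ℕ∞) + 1) w := by exact_mod_cast hw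
    have h1 : ContDiff ℝ 1 w := hw'.of_le (by simp)
    have h2 := ih (hw'.fderiv_right le_rfl)
    have h3 : ContDiff ℝ n (pointwiseApply K E F) := ContinuousLinearMap.contDiff _
    push_cast
    exact contDiff_succ_iff_hasFDerivAt.2
      ⟨fun a => pointwiseApply K E F
        ((⟨fderiv ℝ w, h1.continuous_fderiv one_ne_zero⟩ : C(E, E →L[ℝ] F)).comp a),
        h3.comp h2, fun a => hasFDerivAt_postcomp h1 a⟩

end Nemytskii

section Flow

/-- The compact time interval `[-1, 1]`. -/
abbrev TimeInterval : Type := Set.Icc (-1 : ℝ) 1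

variable {E : Type*} [NormedAddCommGroup E] [NormedSpace ℝ E] [CompleteSpace E]

/-- Extension of a continuous map on `[-1, 1]` to the real line by constants. -/
noncomputable def extendTime (b : C(TimeInterval, E)) (s : ℝ) : E :=
  b (Set.projIcc (-1) 1 (by norm_num) s)

theorem continuous_extendTime (b : C(TimeInterval, E)) : Continuous (extendTime b) :=
  b.continuous.comp continuous_projIcc

theorem extendTime_of_mem (b : C(TimeInterval, E)) {s : ℝ} (hs : s ∈ Set.Icc (-1 : ℝ) 1) :
    extendTime b s = b ⟨s, hs⟩ := by
  rw [extendTime, Set.projIcc_of_mem _ hs]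

theorem norm_integral_extendTime_le (b : C(TimeInterval, E)) (s : TimeInterval) :
    ‖∫ r in (0 : ℝ)..s, extendTime b r‖ ≤ ‖b‖ := by
  refine (intervalIntegral.norm_integral_le_of_norm_le_const
    (fun r _ => b.norm_coe_le_norm _)).trans ?_
  have : |(s : ℝ) - 0| ≤ 1 := by rw [sub_zero]; exact abs_le.2 s.2
  exact mul_le_of_le_one_right (norm_nonneg _) this

/-- The operator sending `b` to its primitive vanishing at `0`. -/
noncomputable def primitive (E : Type*) [NormedAddCommGroup E] [NormedSpace ℝ E] [CompleteSpace E] :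
    C(TimeInterval, E) →L[ℝ] C(TimeInterval, E) :=
  LinearMap.mkContinuous
    { toFun := fun b => ⟨fun s => ∫ r in (0 : ℝ)..s, extendTime b r,
        (intervalIntegral.continuous_primitive
          (fun _ _ => (continuous_extendTime b).intervalIntegrable _ _) 0).comp
          continuous_subtype_val⟩
      map_add' := fun b b' => by
        ext s
        exact intervalIntegral.integral_add ((continuous_extendTime b).intervalIntegrable _ _)
          ((continuous_extendTime b').intervalIntegrable _ _)
      map_smul' := fun c b => by
        ext s
        exact intervalIntegral.integral_smul c _ } 1
    (fun b => by
      rw [one_mul]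
      exact (ContinuousMap.norm_le _ (norm_nonneg _)).2 (norm_integral_extendTime_le b))

/-- The defect `b - x - t ∫ w ∘ b` of a curve `b` as an integral curve of `t w` starting at `x`. -/
noncomputable def flowDefect {w : E → E} (hw : Continuous w) (u : (ℝ × E) × C(TimeInterval, E)) :
    C(TimeInterval, E) :=
  u.2 - ContinuousLinearMap.const ℝ TimeInterval u.1.2
    - u.1.1 • primitive E ((⟨w, hw⟩ : C(E, E)).comp u.2)

theorem flowDefect_eq_zero_iff {w : E → E} (hw : Continuous w) (t : ℝ) (x : E)
    (b : C(TimeInterval, E)) : flowDefect hw ((t, x), b) = 0 ↔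
      ∀ s : TimeInterval, b s = x + t • ∫ r in (0 : ℝ)..s, w (extendTime b r) := by
  rw [ContinuousMap.ext_iff]
  refine forall_congr' fun s => ?_
  have : flowDefect hw ((t, x), b) s = b s - x - t • ∫ r in (0 : ℝ)..s, w (extendTime b r) := rfl
  rw [this, ContinuousMap.zero_apply, sub_sub, sub_eq_zero]

theorem contDiff_flowDefect {n : ℕ} {w : E → E} (hw : ContDiff ℝ n w) :
    ContDiff ℝ n (flowDefect hw.continuous) := by
  have h1 := (contDiff_postcomp (K := TimeInterval) n hw).comp
    (contDiff_snd (E := ℝ × E) (F := C(TimeInterval, E)))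
  have h2 := (primitive E).contDiff.comp h1
  have h3 := ((ContinuousLinearMap.const ℝ TimeInterval (M := E)).contDiff (n := n)).comp
    (contDiff_snd.comp (contDiff_fst (E := ℝ × E) (F := C(TimeInterval, E))))
  exact (contDiff_snd.sub h3).sub ((contDiff_fst.comp contDiff_fst).smul h2)

/-- Rescaling of time by `r ∈ [-1, 1]`. -/
def rescaleTime (r : TimeInterval) : C(TimeInterval, TimeInterval) :=
  ⟨fun s => ⟨r * s, by
    have := abs_mul (r : ℝ) s
    rw [Set.mem_Icc, ← abs_le, this]
    exact mul_le_one₀ (abs_le.2 r.2) (abs_nonneg _) (abs_le.2 s.2)⟩, by fun_prop⟩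

theorem flowDefect_rescaleTime {w : E → E} (hw : Continuous w) {t : ℝ} {x : E}
    {b : C(TimeInterval, E)} (h : flowDefect hw ((t, x), b) = 0) (r : TimeInterval) :
    flowDefect hw ((r * t, x), b.comp (rescaleTime r)) = 0 := by
  rw [flowDefect_eq_zero_iff] at h ⊢
  intro s
  have h1 := h (rescaleTime r s)
  rw [ContinuousMap.comp_apply, h1, mul_comm, mul_smul]
  congr 2
  have h2 := intervalIntegral.smul_integral_comp_mul_left (a := 0) (b := s)
    (fun q => w (extendTime b q)) (r : ℝ)
  rw [mul_zero] at h2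
  refine h2.symm.trans ?_
  congr 1
  refine intervalIntegral.integral_congr fun q hq => ?_
  have hq' : q ∈ Set.Icc (-1 : ℝ) 1 := by
    refine Set.uIcc_subset_Icc (by norm_num) s.2 hq
  have e1 := extendTime_of_mem (b.comp (rescaleTime r)) hq'
  have e2 := extendTime_of_mem b (rescaleTime r ⟨q, hq'⟩).2
  exact congrArg w (e2.trans e1.symm)

theorem exists_contDiffAt_flow {n : ℕ} (hn : n ≠ 0) {w : E → E} (hw : ContDiff ℝ n w) (x₀ : E) :
    ∃ α : ℝ × E → E, ContDiffAt ℝ n α (0, x₀) ∧ (∀ᶠ x in 𝓝 x₀, α (0, x) = x) ∧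
      ∀ᶠ p in 𝓝 ((0 : ℝ), x₀), HasDerivAt (fun s => α (s, p.2)) (w (α p)) p.1 := by
  set c : C(TimeInterval, E) := ContinuousLinearMap.const ℝ TimeInterval x₀ with hc
  set Φ := flowDefect hw.continuous with hΦ
  have hΦn : ContDiff ℝ n Φ := contDiff_flowDefect hw
  have hn' : (n : WithTop ℕ∞) ≠ 0 := by exact_mod_cast hn
  set u₀ : (ℝ × E) × C(TimeInterval, E) := ((0, x₀), c) with hu₀
  have hconst : ∀ x, Φ ((0, x), ContinuousLinearMap.const ℝ TimeInterval x) = 0 := fun x => by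
    simp [hΦ, flowDefect]
  have h0 : Φ u₀ = 0 := hconst x₀
  have hinr : fderiv ℝ Φ u₀ ∘L .inr ℝ (ℝ × E) C(TimeInterval, E) = .id ℝ _ := by
    have h1 : HasFDerivAt (fun b : C(TimeInterval, E) => (((0 : ℝ), x₀), b))
        (.inr ℝ (ℝ × E) C(TimeInterval, E)) c := hasFDerivAt_prodMk_right _ _
    have h2 := ((hΦn.differentiable hn' u₀).hasFDerivAt).comp c h1
    have h3 : HasFDerivAt (fun b : C(TimeInterval, E) => b - c) (.id ℝ _) c :=
      (hasFDerivAt_id c).sub_const c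
    refine h2.unique (h3.congr_of_eventuallyEq (Filter.Eventually.of_forall fun b => ?_))
    simp [hΦ, flowDefect, hc]
  have hinv : (fderiv ℝ Φ u₀ ∘L .inr ℝ (ℝ × E) C(TimeInterval, E)).IsInvertible := by
    rw [hinr]; exact ⟨.refl ℝ _, rfl⟩
  set g := (hΦn.contDiffAt (x := u₀)).implicitFunction hn' hinv with hg
  have hgn : ContDiffAt ℝ n g (0, x₀) :=
    (hΦn.contDiffAt (x := u₀)).contDiffAt_implicitFunction hn' hinv
  have hg0 : g (0, x₀) = c := (hΦn.contDiffAt (x := u₀)).implicitFunction_apply_self hn' hinv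
  have huniq : ∀ᶠ v in 𝓝 u₀, Φ v = 0 ↔ g v.1 = v.2 := by
    have := (hΦn.contDiffAt (x := u₀)).eventually_apply_eq_iff_implicitFunction hn' hinv
    rwa [h0] at this
  have hsol : ∀ᶠ p in 𝓝 ((0 : ℝ), x₀), Φ (p, g p) = 0 := by
    have := (hΦn.contDiffAt (x := u₀)).eventually_apply_implicitFunction hn' hinv
    rwa [h0] at this
  have hscale : ∀ᶠ p in 𝓝 ((0 : ℝ), x₀), ∀ r : TimeInterval,
      g (r * p.1, p.2) = (g p).comp (rescaleTime r) := by
    have h1 : ∀ᶠ p in 𝓝 ((0 : ℝ), x₀), ∀ r ∈ (Set.univ : Set TimeInterval),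
        (Φ ((r * p.1, p.2), (g p).comp (rescaleTime r)) = 0 ↔
          g (r * p.1, p.2) = (g p).comp (rescaleTime r)) := by
      obtain ⟨ε, hε, h⟩ := Metric.eventually_nhds_iff_ball.1 huniq
      have hball : ∀ᶠ p in 𝓝 ((0 : ℝ), x₀), g p ∈ Metric.ball c ε := by
        have := hgn.continuousAt.tendsto
        rw [hg0] at this
        exact this (Metric.ball_mem_nhds c hε)
      filter_upwards [hball, Metric.ball_mem_nhds ((0 : ℝ), x₀) hε] with p hp hp' r _
      refine h ((r * p.1, p.2), (g p).comp (rescaleTime r)) ?_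
      rw [← ball_prod_same] at hp'
      rw [hu₀, ← ball_prod_same, ← ball_prod_same]
      refine ⟨⟨?_, hp'.2⟩, ?_⟩
      · have h1 := hp'.1
        simp only [Metric.mem_ball, dist_zero_right, Real.norm_eq_abs] at h1 ⊢
        rw [abs_mul]
        exact (mul_le_of_le_one_left (abs_nonneg _) (abs_le.2 r.2)).trans_lt h1
      · refine (ContinuousMap.dist_lt_iff hε).2 fun s => ?_
        exact (ContinuousMap.dist_apply_le_dist (f := g p) (g := c) (rescaleTime r s)).trans_lt hp
    filter_upwards [h1, hsol] with p hp hs r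
    exact (hp r (Set.mem_univ r)).1 (flowDefect_rescaleTime hw.continuous hs r)
  let one : TimeInterval := ⟨1, by norm_num⟩
  refine ⟨fun p => g p one, ?_, ?_, ?_⟩
  · exact (ContinuousMap.evalCLM ℝ one).contDiff.contDiffAt.comp (0, x₀) hgn
  · have h1 : Filter.Tendsto (fun x : E =>
        (((0 : ℝ), x), ContinuousLinearMap.const ℝ TimeInterval x)) (𝓝 x₀) (𝓝 u₀) := by
      have : Continuous (fun x : E =>
        (((0 : ℝ), x), ContinuousLinearMap.const ℝ TimeInterval x)) := by fun_prop
      exact this.tendsto x₀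
    filter_upwards [h1.eventually huniq] with x hx
    rw [hx.1 (hconst x)]
    rfl
  · obtain ⟨τ, hτ, H⟩ : ∃ τ > 0, ∀ᶠ x in 𝓝 x₀, Φ ((τ, x), g (τ, x)) = 0 ∧
        ∀ r : TimeInterval, g (r * τ, x) = (g (τ, x)).comp (rescaleTime r) := by
      obtain ⟨ε, hε, h⟩ := Metric.eventually_nhds_iff_ball.1 (hsol.and hscale)
      refine ⟨ε / 2, half_pos hε, ?_⟩
      filter_upwards [Metric.ball_mem_nhds x₀ hε] with x hx
      refine h (ε / 2, x) ?_
      rw [← ball_prod_same]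
      refine ⟨?_, hx⟩
      simp [abs_of_pos hε, hε]
    have h2 : ∀ᶠ t : ℝ in 𝓝 0, |t| < τ := by
      have := Metric.ball_mem_nhds (0 : ℝ) hτ
      filter_upwards [this] with t ht
      simpa using ht
    rw [nhds_prod_eq]
    filter_upwards [h2.prod_mk H] with ⟨t, x⟩ ⟨ht, hx, hr⟩
    simp only at ht hx hr ⊢
    rw [flowDefect_eq_zero_iff] at hx
    have hval : ∀ s, |s| < τ → g (s, x) one =
        x + τ • ∫ r in (0 : ℝ)..(s / τ), w (extendTime (g (τ, x)) r) := fun s hs => by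
      have hm : s / τ ∈ Set.Icc (-1 : ℝ) 1 := by
        rw [Set.mem_Icc, ← abs_le, abs_div, abs_of_pos hτ]
        exact (div_le_one hτ).2 hs.le
      have h3 := hr ⟨s / τ, hm⟩
      rw [div_mul_cancel₀ _ hτ.ne'] at h3
      rw [h3, ← hx ⟨s / τ, hm⟩, ContinuousMap.comp_apply]
      congr 1
      ext
      simp [rescaleTime, one]
    have hval' : g (t, x) one = extendTime (g (τ, x)) (t / τ) := by
      have hm : t / τ ∈ Set.Icc (-1 : ℝ) 1 := by
        rw [Set.mem_Icc, ← abs_le, abs_div, abs_of_pos hτ]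
        exact (div_le_one hτ).2 ht.le
      rw [hval t ht, extendTime_of_mem _ hm, hx ⟨t / τ, hm⟩]
    have h4 := (hw.continuous.comp (continuous_extendTime (g (τ, x)))).integral_hasStrictDerivAt
      0 (t / τ)
    have h5 := (h4.hasDerivAt.scomp t ((hasDerivAt_id t).div_const τ)).const_smul τ |>.const_add x
    rw [smul_smul, mul_one_div_cancel hτ.ne', one_smul, Function.comp_apply, ← hval'] at h5
    refine h5.congr_of_eventuallyEq ?_
    filter_upwards [(continuous_abs.tendsto t).eventually (gt_mem_nhds ht)] with s hs
    exact hval s hs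

end Flow

section Bracket

variable {V E : Type*} [NormedAddCommGroup V] [NormedSpace ℝ V] [FiniteDimensional ℝ V]
  [NormedAddCommGroup E] [NormedSpace ℝ E] [FiniteDimensional ℝ E]

/-- A vector field tangent to an immersed submanifold is related to a vector field on it. -/
theorem exists_related_of_tangent {F : V → E} {u : V} (hF : ContDiffAt ℝ 2 F u)
    (hinj : Function.Injective (fderiv ℝ F u)) {X : E → E} (hX : DifferentiableAt ℝ X (F u))
    (hXt : ∀ᶠ u' in 𝓝 u, X (F u') ∈ Set.range (fderiv ℝ F u')) :
    ∃ ξ : V → V, DifferentiableAt ℝ ξ u ∧ ∀ᶠ u' in 𝓝 u, X (F u') = fderiv ℝ F u' (ξ u') := by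
  obtain ⟨L, hL⟩ := (fderiv ℝ F u).toLinearMap.exists_leftInverse_of_injective
    (LinearMap.ker_eq_bot.2 hinj)
  set L' : E →L[ℝ] V := LinearMap.toContinuousLinearMap L
  have hL' : L' ∘L fderiv ℝ F u = .id ℝ V := by
    ext v; exact LinearMap.congr_fun hL v
  have hA : DifferentiableAt ℝ (fderiv ℝ F) u :=
    (hF.fderiv_right (m := 1) (by norm_num)).differentiableAt one_ne_zero
  set B : V → V →L[ℝ] V := fun u' => L' ∘L fderiv ℝ F u' with hB
  have hBd : DifferentiableAt ℝ B u := (differentiableAt_const L').clm_comp hA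
  have hBu : B u = .id ℝ V := hL'
  have hinv : (B u).IsInvertible := by rw [hBu]; exact ⟨.refl ℝ V, rfl⟩
  have hinvd : DifferentiableAt ℝ (fun u' => (B u').inverse) u :=
    ((hinv.contDiffAt_map_inverse (n := 1)).differentiableAt one_ne_zero).comp u hBd
  have hev : ∀ᶠ u' in 𝓝 u, (B u').IsInvertible := by
    obtain ⟨e, he⟩ := hinv
    have := hBd.continuousAt.tendsto.eventually (he ▸ ContinuousLinearEquiv.nhds e)
    exact this
  refine ⟨fun u' => (B u').inverse (L' (X (F u'))), hinvd.clm_apply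
    (L'.differentiableAt.comp u (hX.comp u (hF.differentiableAt two_ne_zero))), ?_⟩
  filter_upwards [hev, hXt] with u' hu' ⟨ξ, hξ⟩
  have h1 : L' (X (F u')) = B u' ξ := by rw [← hξ]; rfl
  rw [h1, hu'.inverse_apply_eq.2 rfl, hξ]

theorem lieBracket_mem_range_fderiv {F : V → E} {u : V} (hF : ContDiffAt ℝ 2 F u)
    (hinj : Function.Injective (fderiv ℝ F u)) {X Y : E → E} (hX : DifferentiableAt ℝ X (F u))
    (hY : DifferentiableAt ℝ Y (F u))
    (hXt : ∀ᶠ u' in 𝓝 u, X (F u') ∈ Set.range (fderiv ℝ F u'))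
    (hYt : ∀ᶠ u' in 𝓝 u, Y (F u') ∈ Set.range (fderiv ℝ F u')) :
    VectorField.lieBracket ℝ X Y (F u) ∈ Set.range (fderiv ℝ F u) := by
  obtain ⟨ξ, hξ, hξX⟩ := exists_related_of_tangent hF hinj hX hXt
  obtain ⟨η, hη, hηY⟩ := exists_related_of_tangent hF hinj hY hYt
  have hF1 := (hF.differentiableAt two_ne_zero).hasFDerivAt
  have hA : HasFDerivAt (fderiv ℝ F) (fderiv ℝ (fderiv ℝ F) u) u :=
    ((hF.fderiv_right (m := 1) (by norm_num)).differentiableAt one_ne_zero).hasFDerivAt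
  have key : ∀ {Z : E → E} {ζ : V → V}, DifferentiableAt ℝ Z (F u) → DifferentiableAt ℝ ζ u →
      (∀ᶠ u' in 𝓝 u, Z (F u') = fderiv ℝ F u' (ζ u')) → ∀ v, fderiv ℝ Z (F u) (fderiv ℝ F u v) =
        fderiv ℝ F u (fderiv ℝ ζ u v) + fderiv ℝ (fderiv ℝ F) u v (ζ u) := by
    intro Z ζ hZ hζ h v
    have h1 := hZ.hasFDerivAt.comp u hF1
    have h2 := (hA.clm_apply hζ.hasFDerivAt).congr_of_eventuallyEq h
    have := congrArg (fun T : V →L[ℝ] E => T v) (h1.unique h2)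
    simpa using this
  have hsymm : fderiv ℝ (fderiv ℝ F) u (ξ u) (η u) = fderiv ℝ (fderiv ℝ F) u (η u) (ξ u) :=
    hF.isSymmSndFDerivAt (by simp) _ _
  refine ⟨fderiv ℝ η u (ξ u) - fderiv ℝ ξ u (η u), ?_⟩
  rw [VectorField.lieBracket, hξX.self_of_nhds, hηY.self_of_nhds, key hY hη hηY, key hX hξ hξX,
    hsymm, map_sub]
  abel

theorem eventually_injective_of_continuousAt {W : Type*} [TopologicalSpace W] {A : W → V →L[ℝ] E}
    {u : W} (hA : ContinuousAt A u) (hinj : Function.Injective (A u)) :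
    ∀ᶠ u' in 𝓝 u, Function.Injective (A u') := by
  obtain ⟨L, hL⟩ := (A u).toLinearMap.exists_leftInverse_of_injective
    (LinearMap.ker_eq_bot.2 hinj)
  set L' : E →L[ℝ] V := LinearMap.toContinuousLinearMap L
  have hL' : L' ∘L A u = .id ℝ V := by
    ext v; exact LinearMap.congr_fun hL v
  have h1 : ContinuousAt (fun u' => L' ∘L A u') u := continuousAt_const.clm_comp hA
  have h2 : ∀ᶠ T in 𝓝 (L' ∘L A u), ContinuousLinearMap.IsInvertible T := by
    rw [hL']
    exact ContinuousLinearEquiv.nhds (.refl ℝ V)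
  filter_upwards [h1.eventually h2] with u' hu'
  exact Function.Injective.of_comp (f := L') (by
    obtain ⟨e, he⟩ := hu'
    have : (L' ∘ A u') = e := by ext v; exact congrArg (fun T : V →L[ℝ] V => T v) he.symm
    rw [this]; exact e.injective)

end Bracket

section Accessibility

variable {E : Type*} [NormedAddCommGroup E] [NormedSpace ℝ E] [FiniteDimensional ℝ E]

/-- `y` is the image of `x` under a map, continuous at `x`, that preserves `f` near `x`. -/
def Accessible (f : E → ℝ) (x y : E) : Prop :=
  ∃ φ : E → E, ContinuousAt φ x ∧ φ x = y ∧ ∀ᶠ x' in 𝓝 x, f (φ x') = f x'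

theorem Accessible.refl (f : E → ℝ) (x : E) : Accessible f x x :=
  ⟨id, continuousAt_id, rfl, Filter.Eventually.of_forall fun _ => rfl⟩

theorem Accessible.trans {f : E → ℝ} {x y z : E} (h : Accessible f x y) (h' : Accessible f y z) :
    Accessible f x z := by
  obtain ⟨φ, hφ, rfl, hf⟩ := h
  obtain ⟨ψ, hψ, rfl, hg⟩ := h'
  refine ⟨ψ ∘ φ, hψ.comp hφ, rfl, ?_⟩
  filter_upwards [hf, hφ.eventually hg] with x' h1 h2
  exact h2.trans h1

theorem Accessible.apply_eq {f : E → ℝ} {x y : E} (h : Accessible f x y) : f y = f x := by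
  obtain ⟨φ, -, rfl, hf⟩ := h
  exact hf.self_of_nhds

theorem Accessible.eventually_eq {f : E → ℝ} {x y : E} (h : Accessible f x y)
    (hy : ∀ᶠ y' in 𝓝 y, f y' = f y) : ∀ᶠ x' in 𝓝 x, f x' = f x := by
  have h0 := h.apply_eq
  obtain ⟨φ, hφ, rfl, hf⟩ := h
  filter_upwards [hf, hφ.eventually hy] with x' h1 h2
  rw [← h1, h2, h0]

/-- An immersion germ with values accessible from `x`. -/
structure IsAccessibleImmersionAt {V : Type*} [NormedAddCommGroup V] [NormedSpace ℝ V]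
    (f : E → ℝ) (x : E) (F : V → E) (u : V) : Prop where
  contDiffAt : ContDiffAt ℝ 2 F u
  injective : Function.Injective (fderiv ℝ F u)
  accessible : ∀ᶠ u' in 𝓝 u, Accessible f x (F u')

theorem IsAccessibleImmersionAt.eventually {V : Type*} [NormedAddCommGroup V] [NormedSpace ℝ V]
    [FiniteDimensional ℝ V] {f : E → ℝ} {x : E} {F : V → E} {u : V}
    (h : IsAccessibleImmersionAt f x F u) : ∀ᶠ u' in 𝓝 u, IsAccessibleImmersionAt f x F u' := by
  have hc : ContinuousAt (fderiv ℝ F) u :=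
    (h.contDiffAt.fderiv_right (m := 1) (by norm_num)).continuousAt
  filter_upwards [h.contDiffAt.eventually (by simp), eventually_injective_of_continuousAt hc
    h.injective, eventually_eventually_nhds.2 h.accessible] with u' h1 h2 h3
  exact ⟨h1, h2, h3⟩

theorem IsAccessibleImmersionAt.extend {V : Type*} [NormedAddCommGroup V] [NormedSpace ℝ V]
    {f : E → ℝ} {x : E} {F : V → E} {u : V} (h : IsAccessibleImmersionAt f x F u)
    {φ : ℝ × E → E} (hφ : ContDiffAt ℝ 2 φ (0, F u)) (hφ0 : ∀ᶠ y in 𝓝 (F u), φ (0, y) = y)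
    {v : E} (hφv : HasDerivAt (fun t => φ (t, F u)) v 0)
    (hφf : ∀ᶠ p in 𝓝 ((0 : ℝ), F u), f (φ p) = f p.2) (hv : v ∉ Set.range (fderiv ℝ F u)) :
    IsAccessibleImmersionAt f x (fun q : ℝ × V => φ (q.1, F q.2)) (0, u) := by
  have hq : ContDiffAt ℝ 2 (fun q : ℝ × V => (q.1, F q.2)) (0, u) :=
    contDiffAt_fst.prodMk (h.contDiffAt.comp (0, u) contDiffAt_snd)
  have hFd := (h.contDiffAt.differentiableAt two_ne_zero).hasFDerivAt
  have hφd := (hφ.differentiableAt two_ne_zero).hasFDerivAt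
  set D := fderiv ℝ φ (0, F u)
  have hD1 : D (1, 0) = v := by
    have h1 : HasDerivAt (fun t : ℝ => (t, F u)) ((1 : ℝ), (0 : E)) 0 :=
      (hasDerivAt_id (0 : ℝ)).prodMk (hasDerivAt_const _ _)
    exact (hφd.comp_hasDerivAt (0 : ℝ) h1).unique hφv
  have hD2 : ∀ ξ, D (0, ξ) = ξ := fun ξ => by
    have h1 := hφd.comp (F u) (hasFDerivAt_prodMk_right (𝕜 := ℝ) (0 : ℝ) (F u))
    have h2 := (hasFDerivAt_id (𝕜 := ℝ) (F u)).congr_of_eventuallyEq (f₁ := fun y => φ (0, y)) hφ0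
    exact congrArg (fun T : E →L[ℝ] E => T ξ) (h1.unique h2)
  have hD : ∀ s ξ, D (s, ξ) = s • v + ξ := fun s ξ => by
    have : ((s, ξ) : ℝ × E) = s • ((1 : ℝ), (0 : E)) + (0, ξ) := by simp
    rw [this, map_add, map_smul, hD1, hD2]
  have hder : HasFDerivAt (fun q : ℝ × V => φ (q.1, F q.2))
      (D ∘L ((ContinuousLinearMap.fst ℝ ℝ V).prod
        (fderiv ℝ F u ∘L ContinuousLinearMap.snd ℝ ℝ V))) (0, u) := by
    have h1 : HasFDerivAt (fun q : ℝ × V => F q.2)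
      (fderiv ℝ F u ∘L ContinuousLinearMap.snd ℝ ℝ V) (0, u) :=
      HasFDerivAt.comp (g := F) (0, u) hFd hasFDerivAt_snd
    exact HasFDerivAt.comp (g := φ) (0, u) hφd (hasFDerivAt_fst.prodMk h1)
  refine ⟨hφ.comp (0, u) hq, ?_, ?_⟩
  · rw [hder.fderiv]
    refine (injective_iff_map_eq_zero _).2 fun ⟨s, η⟩ hs => ?_
    change D (s, fderiv ℝ F u η) = 0 at hs
    rw [hD] at hs
    have hs0 : s = 0 := by
      by_contra hne
      refine hv ⟨-(s⁻¹ • η), ?_⟩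
      rw [map_neg, map_smul, neg_eq_iff_eq_neg, inv_smul_eq_iff₀ hne, smul_neg]
      exact eq_neg_of_add_eq_zero_right hs
    subst hs0
    rw [zero_smul, zero_add] at hs
    have := (injective_iff_map_eq_zero _).1 h.injective η hs
    simp [this]
  · have h1 : ∀ᶠ p in 𝓝 ((0 : ℝ), F u), ContinuousAt φ p ∧ ∀ᶠ p' in 𝓝 p, f (φ p') = f p'.2 := by
      filter_upwards [hφ.eventually (by simp), eventually_eventually_nhds.2 hφf] with p h1 h2
      exact ⟨h1.continuousAt, h2⟩
    have h2 := hq.continuousAt.eventually h1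
    have h3 : ∀ᶠ q : ℝ × V in 𝓝 (0, u), Accessible f x (F q.2) :=
      (continuous_snd.tendsto ((0 : ℝ), u)).eventually h.accessible
    filter_upwards [h2, h3] with q ⟨hc, hf⟩ hacc
    have h4 : ContinuousAt (fun y : E => (q.1, y)) (F q.2) := by fun_prop
    exact hacc.trans ⟨fun y => φ (q.1, y), ContinuousAt.comp (g := φ) hc h4, rfl,
      h4.eventually hf⟩

/-- If `f` is preserved by flow germs in all directions of `D`, and the directions of `D` are
tangent to no proper immersed submanifold, then `f` is locally constant. -/
theorem eventually_eq_of_flows {Ω : Set E} (hΩ : IsOpen Ω) (D : E → Set E) (f : E → ℝ)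
    (hflow : ∀ x ∈ Ω, ∀ v ∈ D x, ∃ φ : ℝ × E → E, ContDiffAt ℝ 2 φ (0, x) ∧
      (∀ᶠ y in 𝓝 x, φ (0, y) = y) ∧ HasDerivAt (fun t => φ (t, x)) v 0 ∧
      ∀ᶠ p in 𝓝 ((0 : ℝ), x), f (φ p) = f p.2)
    (hgen : ∀ (V : Type) [NormedAddCommGroup V] [NormedSpace ℝ V] [FiniteDimensional ℝ V]
      (F : V → E) (u : V), ContDiffAt ℝ 2 F u → Function.Injective (fderiv ℝ F u) → F u ∈ Ω →
      (∀ᶠ u' in 𝓝 u, D (F u') ⊆ Set.range (fderiv ℝ F u')) →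
      Function.Surjective (fderiv ℝ F u))
    {x : E} (hx : x ∈ Ω) : ∀ᶠ y in 𝓝 x, f y = f x := by
  let P : ℕ → Prop := fun r => ∃ (V : Type) (_ : NormedAddCommGroup V) (_ : NormedSpace ℝ V)
    (_ : FiniteDimensional ℝ V) (F : V → E) (u : V), Module.finrank ℝ V = r ∧ F u ∈ Ω ∧
    IsAccessibleImmersionAt f x F u
  have hP0 : P 0 := by
    refine ⟨Fin 0 → ℝ, inferInstance, inferInstance, inferInstance, fun _ => x, 0, by simp, hx,
      contDiffAt_const, Function.injective_of_subsingleton _,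
      Filter.Eventually.of_forall fun _ => Accessible.refl f x⟩
  have hPle : ∀ r, P r → r ≤ Module.finrank ℝ E := by
    rintro r ⟨V, _, _, _, F, u, rfl, -, h⟩
    exact LinearMap.finrank_le_finrank_of_injective (f := (fderiv ℝ F u).toLinearMap) h.injective
  obtain ⟨r, hr, hmax⟩ : ∃ r, P r ∧ ¬ P (r + 1) := by
    by_contra! hcon
    have : ∀ r, P r := fun r => Nat.rec hP0 hcon r
    have := hPle _ (this (Module.finrank ℝ E + 1))
    omega
  obtain ⟨V, _, _, _, F, u, hrank, hu, h⟩ := hr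
  have hΩu : ∀ᶠ u' in 𝓝 u, F u' ∈ Ω := h.contDiffAt.continuousAt.eventually (hΩ.mem_nhds hu)
  have htan : ∀ᶠ u' in 𝓝 u, D (F u') ⊆ Set.range (fderiv ℝ F u') := by
    filter_upwards [hΩu, h.eventually] with u' hu' h' v hv
    by_contra hne
    obtain ⟨φ, h1, h2, h3, h4⟩ := hflow _ hu' v hv
    refine hmax ⟨ℝ × V, inferInstance, inferInstance, inferInstance, _, (0, u'), ?_, ?_,
      h'.extend h1 h2 h3 h4 hne⟩
    · rw [Module.finrank_prod, hrank, Module.finrank_self, add_comm]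
    · simpa [h2.self_of_nhds] using hu'
  have hsurj := hgen V F u h.contDiffAt h.injective hu htan
  have hmap := (h.contDiffAt.hasStrictFDerivAt two_ne_zero).map_nhds_eq_of_surj
    (LinearMap.range_eq_top.2 hsurj)
  have hacc : ∀ᶠ y in 𝓝 (F u), Accessible f x y := by
    rw [← hmap]; exact h.accessible
  refine hacc.self_of_nhds.eventually_eq ?_
  filter_upwards [hacc] with y hy
  rw [hy.apply_eq, hacc.self_of_nhds.apply_eq]

end Accessibility

theorem eq_of_convexOn_of_bddAbove_range {g : ℝ → ℝ} (hg : ConvexOn ℝ Set.univ g)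
    (hb : BddAbove (Set.range g)) (a b : ℝ) : g a = g b := by
  obtain ⟨C, hC⟩ := hb
  have key : ∀ a b, g b ≤ g a := by
    intro a b
    by_contra! hlt
    obtain ⟨n, hn⟩ := exists_nat_gt ((C - g a) / (g b - g a))
    rw [div_lt_iff₀ (sub_pos.2 hlt)] at hn
    have hCa : g a ≤ C := hC ⟨a, rfl⟩
    have hn0 : 0 < (n : ℝ) := by
      by_contra! h
      have : (n : ℝ) * (g b - g a) ≤ 0 := mul_nonpos_of_nonpos_of_nonneg h (sub_pos.2 hlt).le
      linarith
    have hn1 : (1 : ℝ) ≤ n := by exact_mod_cast Nat.cast_pos.1 hn0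
    have h := hg.2 (Set.mem_univ a) (Set.mem_univ (a + n * (b - a)))
      (show (0 : ℝ) ≤ 1 - 1 / n by rw [sub_nonneg, div_le_one hn0]; exact hn1)
      (show (0 : ℝ) ≤ 1 / n by positivity) (by ring)
    have e : (1 - 1 / (n : ℝ)) • a + (1 / (n : ℝ)) • (a + n * (b - a)) = b := by
      simp only [smul_eq_mul]; field_simp; ring
    rw [e] at h
    have h2 : g (a + n * (b - a)) ≤ C := hC ⟨_, rfl⟩
    simp only [smul_eq_mul] at h
    have h3 : (n : ℝ) * g b ≤ (n - 1) * g a + g (a + n * (b - a)) := by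
      have := mul_le_mul_of_nonneg_left h hn0.le
      have e2 : (n : ℝ) * ((1 - 1 / (n : ℝ)) * g a + 1 / (n : ℝ) * g (a + n * (b - a))) =
        (n - 1) * g a + g (a + n * (b - a)) := by field_simp
      linarith
    linarith
  exact le_antisymm (key b a) (key a b)

theorem exists_contDiff_eventuallyEq {E F : Type*} [NormedAddCommGroup E] [NormedSpace ℝ E]
    [FiniteDimensional ℝ E] [NormedAddCommGroup F] [NormedSpace ℝ F] {n : ℕ} {w : E → F} {x : E}
    (hw : ContDiffAt ℝ n w x) : ∃ w' : E → F, ContDiff ℝ n w' ∧ w' =ᶠ[𝓝 x] w := by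
  obtain ⟨r, hr, h⟩ := Metric.eventually_nhds_iff_ball.1 (hw.eventually (by simp))
  let f : ContDiffBump x := ⟨r / 4, r / 2, by positivity, by linarith⟩
  refine ⟨fun y => f y • w y, contDiff_iff_contDiffAt.2 fun y => ?_, ?_⟩
  · by_cases hy : y ∈ Metric.ball x r
    · exact f.contDiff.contDiffAt.smul (h y hy)
    · have h1 : y ∉ tsupport f := fun hy' => hy (by
        rw [f.tsupport_eq] at hy'
        exact Metric.closedBall_subset_ball (by change r / 2 < r; linarith) hy')
      have h2 := notMem_tsupport_iff_eventuallyEq.1 h1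
      refine (contDiffAt_const (c := (0 : F))).congr_of_eventuallyEq ?_
      filter_upwards [h2] with z hz
      simp [hz]
  · filter_upwards [f.eventuallyEq_one] with y hy
    simp [hy]

variable {E : Type*} [NormedAddCommGroup E] [NormedSpace ℝ E] [FiniteDimensional ℝ E]
  {M : Type*} [TopologicalSpace M] [ChartedSpace E M] [IsManifold 𝓘(ℝ, E) ∞ M]

theorem isManifold_minSmoothness : IsManifold 𝓘(ℝ, E) (minSmoothness ℝ 2) M :=
  .of_le (n := ∞) (by
    rw [minSmoothness_of_isRCLikeNormedField]; exact WithTop.coe_le_coe.2 (le_top : (2 : ℕ∞) ≤ ⊤))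

section Chart

variable (p : M)

/-- A vector field on `M` in the preferred chart at `p`. -/
noncomputable def chartField (X : Π x : M, TangentSpace 𝓘(ℝ, E) x) : E → E :=
  VectorField.mpullback 𝓘(ℝ, E) 𝓘(ℝ, E) (extChartAt 𝓘(ℝ, E) p).symm X

variable {p} {x : E}

theorem contMDiffAt_chart_symm (hx : x ∈ (extChartAt 𝓘(ℝ, E) p).target) :
    ContMDiffAt 𝓘(ℝ, E) 𝓘(ℝ, E) ∞ (extChartAt 𝓘(ℝ, E) p).symm x :=
  (contMDiffOn_extChartAt_symm p).contMDiffAt ((isOpen_extChartAt_target p).mem_nhds hx)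

theorem isInvertible_mfderiv_chart_symm (hx : x ∈ (extChartAt 𝓘(ℝ, E) p).target) :
    (mfderiv 𝓘(ℝ, E) 𝓘(ℝ, E) (extChartAt 𝓘(ℝ, E) p).symm x).IsInvertible := by
  have : IsManifold 𝓘(ℝ, E) 1 M := .of_le (n := ∞) (by exact_mod_cast le_top)
  have := isInvertible_mfderivWithin_extChartAt_symm (I := 𝓘(ℝ, E)) (x := p) hx
  rwa [ModelWithCorners.range_eq_univ, mfderivWithin_univ] at this

theorem mfderiv_chart_symm_chartField (hx : x ∈ (extChartAt 𝓘(ℝ, E) p).target)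
    (X : Π x : M, TangentSpace 𝓘(ℝ, E) x) :
    mfderiv 𝓘(ℝ, E) 𝓘(ℝ, E) (extChartAt 𝓘(ℝ, E) p).symm x (chartField (E := E) p X x) =
      X ((extChartAt 𝓘(ℝ, E) p).symm x) := by
  obtain ⟨e, he⟩ := isInvertible_mfderiv_chart_symm hx
  rw [chartField, VectorField.mpullback_apply, ← he, ContinuousLinearMap.inverse_equiv]
  exact e.apply_symm_apply _

theorem contDiffAt_chartField (hx : x ∈ (extChartAt 𝓘(ℝ, E) p).target)
    {X : Π x : M, TangentSpace 𝓘(ℝ, E) x}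
    (hX : CMDiffAt ∞ (T% X) ((extChartAt 𝓘(ℝ, E) p).symm x)) :
    ContDiffAt ℝ ∞ (chartField p X) x := by
  have := hX.mpullback_vectorField_preimage (contMDiffAt_chart_symm hx)
    (isInvertible_mfderiv_chart_symm hx) (by simp)
  exact contMDiffAt_vectorSpace_iff_contDiffAt.1 this

theorem chartField_mlieBracket (hx : x ∈ (extChartAt 𝓘(ℝ, E) p).target)
    {X Y : Π x : M, TangentSpace 𝓘(ℝ, E) x}
    (hX : CMDiffAt ∞ (T% X) ((extChartAt 𝓘(ℝ, E) p).symm x))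
    (hY : CMDiffAt ∞ (T% Y) ((extChartAt 𝓘(ℝ, E) p).symm x)) :
    chartField p (VectorField.mlieBracket 𝓘(ℝ, E) X Y) x =
      VectorField.lieBracket ℝ (chartField p X) (chartField p Y) x := by
  have : IsManifold 𝓘(ℝ, E) (minSmoothness ℝ 2) M := isManifold_minSmoothness
  have := VectorField.mpullback_mlieBracket (hX.mdifferentiableAt (by simp))
    (hY.mdifferentiableAt (by simp)) (contMDiffAt_chart_symm hx)
    (by rw [minSmoothness_of_isRCLikeNormedField]; exact WithTop.coe_le_coe.2 (le_top : (2 : ℕ∞) ≤ ⊤))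
  rw [← VectorField.mlieBracketWithin_univ (I := 𝓘(ℝ, E)) (M := E),
    VectorField.mlieBracketWithin_eq_lieBracketWithin] at this
  exact this.trans (congrFun VectorField.lieBracketWithin_univ x)

theorem contDiffAt_comp_chart_symm (hx : x ∈ (extChartAt 𝓘(ℝ, E) p).target) {g : M → ℝ}
    (hg : ContMDiffAt 𝓘(ℝ, E) 𝓘(ℝ, ℝ) ∞ g ((extChartAt 𝓘(ℝ, E) p).symm x)) :
    ContDiffAt ℝ ∞ (fun y => g ((extChartAt 𝓘(ℝ, E) p).symm y)) x :=
  (hg.comp x (contMDiffAt_chart_symm hx)).contDiffAt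

theorem mvfderiv_eq_fderiv_chart (hx : x ∈ (extChartAt 𝓘(ℝ, E) p).target) {g : M → ℝ}
    (hg : ContMDiffAt 𝓘(ℝ, E) 𝓘(ℝ, ℝ) ∞ g ((extChartAt 𝓘(ℝ, E) p).symm x))
    (X : Π x : M, TangentSpace 𝓘(ℝ, E) x) :
    mvfderiv 𝓘(ℝ, E) g ((extChartAt 𝓘(ℝ, E) p).symm x) (X ((extChartAt 𝓘(ℝ, E) p).symm x)) =
      fderiv ℝ (fun y => g ((extChartAt 𝓘(ℝ, E) p).symm y)) x (chartField (E := E) p X x) := by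
  have h := mvfderiv_comp_apply x (hg.mdifferentiableAt (by simp))
    ((contMDiffAt_chart_symm hx).mdifferentiableAt (by simp)) (chartField (E := E) p X x)
  rw [mfderiv_chart_symm_chartField hx] at h
  rw [← h, mvfderiv, mfderiv_eq_fderiv]
  rfl

end Chart

namespace HorizontalBundle

variable {k : ℕ} (S : HorizontalBundle 𝓘(ℝ, E) M k)

/-- The directions at `x`, in the chart at `p`, of the distribution. -/
def chartFiber (p : M) (x : E) : Set E :=
  {v | mfderiv 𝓘(ℝ, E) 𝓘(ℝ, E) (extChartAt 𝓘(ℝ, E) p).symm x v ∈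
    S.fiber ((extChartAt 𝓘(ℝ, E) p).symm x)}

variable {S}

theorem IsCommutator.contMDiff {i : ℕ} {X : Π x : M, TangentSpace 𝓘(ℝ, E) x}
    (hX : S.IsCommutator i X) : CMDiff ∞ (T% X) := by
  induction hX with
  | of_section hX => exact hX.1
  | bracket hX hY ih => 
    have : IsManifold 𝓘(ℝ, E) (minSmoothness ℝ 2) M := isManifold_minSmoothness
    have : IsManifold 𝓘(ℝ, E) ((⊤ : ℕ∞) + 1) M := .of_le (n := ∞) (by simp)
    exact fun x => (hX.1 x).mlieBracket_vectorField (m := ⊤) (n := ⊤) (ih x) (by simp)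

theorem IsCommutator.eventually_chartField_mem_range {V : Type*} [NormedAddCommGroup V]
    [NormedSpace ℝ V] [FiniteDimensional ℝ V] {p : M} {F : V → E} {u : V}
    (hF : ContDiffAt ℝ 2 F u) (hinj : Function.Injective (fderiv ℝ F u))
    (hu : F u ∈ (extChartAt 𝓘(ℝ, E) p).target)
    (htan : ∀ᶠ u' in 𝓝 u, S.chartFiber p (F u') ⊆ Set.range (fderiv ℝ F u'))
    {i : ℕ} {X : Π x : M, TangentSpace 𝓘(ℝ, E) x} (hX : S.IsCommutator i X) :
    ∀ᶠ u' in 𝓝 u, chartField p X (F u') ∈ Set.range (fderiv ℝ F u') := by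
  have hev : ∀ᶠ u' in 𝓝 u, F u' ∈ (extChartAt 𝓘(ℝ, E) p).target :=
    hF.continuousAt.eventually ((isOpen_extChartAt_target p).mem_nhds hu)
  have hsec : ∀ {X : Π x : M, TangentSpace 𝓘(ℝ, E) x}, S.IsSection X →
      ∀ᶠ u' in 𝓝 u, chartField p X (F u') ∈ Set.range (fderiv ℝ F u') := by
    intro X hX
    filter_upwards [hev, htan] with u' h1 h2
    refine h2 ?_
    have := hX.2 ((extChartAt 𝓘(ℝ, E) p).symm (F u'))
    rwa [← mfderiv_chart_symm_chartField h1 X] at this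
  induction hX with
  | of_section hX => exact hsec hX
  | bracket hX hY ih =>
    have hc : ContinuousAt (fderiv ℝ F) u :=
      (hF.fderiv_right (m := 1) (by norm_num)).continuousAt
    filter_upwards [hev, hF.eventually (by simp), eventually_injective_of_continuousAt hc hinj,
      eventually_eventually_nhds.2 ih, eventually_eventually_nhds.2 (hsec hX)] with u' h1 h2 h3 h4 h5
    rw [chartField_mlieBracket h1 hX.1.contMDiffAt hY.contMDiff.contMDiffAt]
    exact lieBracket_mem_range_fderiv h2 h3
      ((contDiffAt_chartField h1 hX.1.contMDiffAt).differentiableAt (by simp))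
      ((contDiffAt_chartField h1 hY.contMDiff.contMDiffAt).differentiableAt (by simp)) h5 h4

theorem surjective_fderiv_of_tangent {V : Type*} [NormedAddCommGroup V]
    [NormedSpace ℝ V] [FiniteDimensional ℝ V] {p : M} {F : V → E} {u : V}
    (hF : ContDiffAt ℝ 2 F u) (hinj : Function.Injective (fderiv ℝ F u))
    (hu : F u ∈ (extChartAt 𝓘(ℝ, E) p).target)
    (htan : ∀ᶠ u' in 𝓝 u, S.chartFiber p (F u') ⊆ Set.range (fderiv ℝ F u'))
    {l : ℕ} (hl : S.flag l ((extChartAt 𝓘(ℝ, E) p).symm (F u)) = ⊤) :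
    Function.Surjective (fderiv ℝ F u) := by
  intro w
  set A := mfderiv 𝓘(ℝ, E) 𝓘(ℝ, E) (extChartAt 𝓘(ℝ, E) p).symm (F u)
  have hle : S.flag l ((extChartAt 𝓘(ℝ, E) p).symm (F u)) ≤
      (fderiv ℝ F u).toLinearMap.range.map A.toLinearMap := by
    refine Submodule.span_le.2 ?_
    rintro _ ⟨j, -, X, hX, rfl⟩
    obtain ⟨v, hv⟩ := (hX.eventually_chartField_mem_range hF hinj hu htan).self_of_nhds
    refine ⟨_, ⟨v, rfl⟩, ?_⟩
    exact (congrArg A hv).trans (mfderiv_chart_symm_chartField hu X)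
  rw [hl] at hle
  obtain ⟨_, ⟨v, rfl⟩, h⟩ := hle (Submodule.mem_top (x := A w))
  exact ⟨v, (isInvertible_mfderiv_chart_symm hu).bijective.injective h⟩

end HorizontalBundle

section Smoothness

variable [RiemannianBundle (fun x : M => TangentSpace 𝓘(ℝ, E) x)]
  [IsContMDiffRiemannianBundle 𝓘(ℝ, E) ∞ E (fun x : M => TangentSpace 𝓘(ℝ, E) x)]
  {p : M} {x : E} {U : Set M}

theorem eventually_chart_symm_mem (hx : x ∈ (extChartAt 𝓘(ℝ, E) p).target) (hU : IsOpen U)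
    (hxU : (extChartAt 𝓘(ℝ, E) p).symm x ∈ U) :
    ∀ᶠ y in 𝓝 x, y ∈ (extChartAt 𝓘(ℝ, E) p).target ∧ (extChartAt 𝓘(ℝ, E) p).symm y ∈ U :=
  Filter.Eventually.and ((isOpen_extChartAt_target p).mem_nhds hx)
    ((contMDiffAt_chart_symm hx).continuousAt.eventually (hU.mem_nhds hxU))

theorem contMDiffAt_inner {X Y : Π x : M, TangentSpace 𝓘(ℝ, E) x} {q : M}
    (hX : CMDiffAt ∞ (T% X) q) (hY : CMDiffAt ∞ (T% Y) q) :
    ContMDiffAt 𝓘(ℝ, E) 𝓘(ℝ, ℝ) ∞ (fun y => inner ℝ (X y) (Y y)) q :=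
  ContMDiffAt.inner_bundle (IB := 𝓘(ℝ, E)) (F := E) (E := fun x : M => TangentSpace 𝓘(ℝ, E) x)
    hX hY

theorem contDiffAt_mvfderiv_chart (hx : x ∈ (extChartAt 𝓘(ℝ, E) p).target) (hU : IsOpen U)
    (hxU : (extChartAt 𝓘(ℝ, E) p).symm x ∈ U) {g : M → ℝ}
    (hg : ∀ q ∈ U, ContMDiffAt 𝓘(ℝ, E) 𝓘(ℝ, ℝ) ∞ g q) {X : Π x : M, TangentSpace 𝓘(ℝ, E) x}
    (hX : ∀ q ∈ U, CMDiffAt ∞ (T% X) q) :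
    ContDiffAt ℝ ∞ (fun y => mvfderiv 𝓘(ℝ, E) g ((extChartAt 𝓘(ℝ, E) p).symm y)
      (X ((extChartAt 𝓘(ℝ, E) p).symm y))) x := by
  have h1 := (contDiffAt_comp_chart_symm hx (hg _ hxU)).fderiv_right (m := ∞) (by simp)
  refine (h1.clm_apply (contDiffAt_chartField hx (hX _ hxU))).congr_of_eventuallyEq ?_
  filter_upwards [eventually_chart_symm_mem hx hU hxU] with y hy
  exact mvfderiv_eq_fderiv_chart hy.1 (hg _ hy.2) X

theorem contDiffAt_koszul_chart (hx : x ∈ (extChartAt 𝓘(ℝ, E) p).target) (hU : IsOpen U)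
    (hxU : (extChartAt 𝓘(ℝ, E) p).symm x ∈ U) {X Y Z : Π x : M, TangentSpace 𝓘(ℝ, E) x}
    (hX : ∀ q ∈ U, CMDiffAt ∞ (T% X) q) (hY : ∀ q ∈ U, CMDiffAt ∞ (T% Y) q)
    (hZ : ∀ q ∈ U, CMDiffAt ∞ (T% Z) q) :
    ContDiffAt ℝ ∞ (fun y => koszul 𝓘(ℝ, E) X Y Z ((extChartAt 𝓘(ℝ, E) p).symm y)) x := by
  have : IsManifold 𝓘(ℝ, E) (minSmoothness ℝ 2) M := isManifold_minSmoothness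
  have : IsManifold 𝓘(ℝ, E) ((⊤ : ℕ∞) + 1) M := .of_le (n := ∞) (by simp)
  have hbr : ∀ {A B C : Π x : M, TangentSpace 𝓘(ℝ, E) x}, (∀ q ∈ U, CMDiffAt ∞ (T% A) q) →
      (∀ q ∈ U, CMDiffAt ∞ (T% B) q) → (∀ q ∈ U, CMDiffAt ∞ (T% C) q) →
      ContDiffAt ℝ ∞ (fun y => inner ℝ
        (VectorField.mlieBracket 𝓘(ℝ, E) A B ((extChartAt 𝓘(ℝ, E) p).symm y))
        (C ((extChartAt 𝓘(ℝ, E) p).symm y))) x := fun hA hB hC =>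
    contDiffAt_comp_chart_symm hx (contMDiffAt_inner
      ((hA _ hxU).mlieBracket_vectorField (m := ⊤) (n := ⊤) (hB _ hxU) (by simp)) (hC _ hxU))
  have hd : ∀ {A B C : Π x : M, TangentSpace 𝓘(ℝ, E) x}, (∀ q ∈ U, CMDiffAt ∞ (T% A) q) →
      (∀ q ∈ U, CMDiffAt ∞ (T% B) q) → (∀ q ∈ U, CMDiffAt ∞ (T% C) q) →
      ContDiffAt ℝ ∞ (fun y => mvfderiv 𝓘(ℝ, E) (fun q => inner ℝ (A q) (B q))
        ((extChartAt 𝓘(ℝ, E) p).symm y) (C ((extChartAt 𝓘(ℝ, E) p).symm y))) x :=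
    fun hA hB hC => contDiffAt_mvfderiv_chart hx hU hxU
      (fun q hq => contMDiffAt_inner (hA q hq) (hB q hq)) hC
  exact (((((hd hY hZ hX).add (hd hX hZ hY)).sub (hd hX hY hZ)).add (hbr hX hY hZ)).sub
    (hbr hX hZ hY)).sub (hbr hY hZ hX)

end Smoothness

section Gram

variable {V : Type*} [NormedAddCommGroup V] [InnerProductSpace ℝ V] {k : ℕ}

/-- The Gram operator of a finite family of vectors. -/
noncomputable def gramOperator (e : Fin k → V) : (Fin k → ℝ) →L[ℝ] (Fin k → ℝ) :=
  LinearMap.toContinuousLinearMap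
    { toFun := fun η a => inner ℝ (e a) (∑ b, η b • e b)
      map_add' := fun η η' => by
        ext a; simp [add_smul, Finset.sum_add_distrib, inner_add_right]
      map_smul' := fun c η => by
        ext a; simp [mul_smul, ← Finset.smul_sum, inner_smul_right] }

theorem gramOperator_apply (e : Fin k → V) (η : Fin k → ℝ) (a : Fin k) :
    gramOperator e η a = inner ℝ (e a) (∑ b, η b • e b) := rfl

theorem gramOperator_apply_eq_sum (e : Fin k → V) (η : Fin k → ℝ) (a : Fin k) :
    gramOperator e η a = ∑ b, η b * inner ℝ (e a) (e b) := by
  simp [gramOperator_apply, inner_sum, inner_smul_right]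

theorem eq_zero_of_mem_span_of_inner {e : Fin k → V} {v : V}
    (hv : v ∈ Submodule.span ℝ (Set.range e)) (h : ∀ a, inner ℝ (e a) v = 0) : v = 0 := by
  have h1 : Submodule.span ℝ (Set.range e) ≤ (innerSL ℝ v).toLinearMap.ker :=
    Submodule.span_le.2 (by
      rintro _ ⟨a, rfl⟩
      exact (real_inner_comm _ _).trans (h a))
  exact inner_self_eq_zero.1 (h1 hv : inner ℝ v v = 0)

theorem isInvertible_gramOperator {e : Fin k → V} (he : LinearIndependent ℝ e) :
    (gramOperator e).IsInvertible := by
  have hinj : Function.Injective (gramOperator e).toLinearMap := by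
    refine (injective_iff_map_eq_zero _).2 fun η hη => ?_
    have h0 : ∑ b, η b • e b = 0 := by
      refine eq_zero_of_mem_span_of_inner
        (Submodule.sum_mem _ fun b _ => Submodule.smul_mem _ _ (Submodule.subset_span ⟨b, rfl⟩))
        fun a => congrFun hη a
    exact funext (Fintype.linearIndependent_iff.1 he η h0)
  exact ⟨(LinearEquiv.ofInjectiveEndo _ hinj).toContinuousLinearEquiv, by ext; rfl⟩

/-- Coordinates of `v` with respect to the family `e`. -/
theorem sum_gramOperator_inverse_smul {e : Fin k → V} (he : LinearIndependent ℝ e) {v : V}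
    (hv : v ∈ Submodule.span ℝ (Set.range e)) :
    ∑ l, (gramOperator e).inverse (fun a => inner ℝ (e a) v) l • e l = v := by
  set η := (gramOperator e).inverse (fun a => inner ℝ (e a) v) with hη
  have h1 : gramOperator e η = fun a => inner ℝ (e a) v :=
    ((isInvertible_gramOperator he).inverse_apply_eq.1 hη.symm).symm
  rw [← sub_eq_zero]
  refine eq_zero_of_mem_span_of_inner (Submodule.sub_mem _ (Submodule.sum_mem _ fun b _ =>
    Submodule.smul_mem _ _ (Submodule.subset_span ⟨b, rfl⟩)) hv) fun a => ?_
  rw [inner_sub_right, ← gramOperator_apply, h1, sub_self]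

end Gram

namespace HorizontalBundle

variable [RiemannianBundle (fun x : M => TangentSpace 𝓘(ℝ, E) x)]
  [IsContMDiffRiemannianBundle 𝓘(ℝ, E) ∞ E (fun x : M => TangentSpace 𝓘(ℝ, E) x)]
  {k : ℕ} {S : HorizontalBundle 𝓘(ℝ, E) M k} {p : M} {x : E} {U : Set M}
  {X : Fin k → Π x : M, TangentSpace 𝓘(ℝ, E) x}

theorem inner_horizontalConnection {A B C : Π x : M, TangentSpace 𝓘(ℝ, E) x} {q : M}
    (hA : MDiffAt (T% A) q) (hB : MDiffAt (T% B) q) (hC : MDiffAt (T% C) q)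
    (hCS : C q ∈ S.fiber q) :
    inner ℝ (C q) (S.horizontalConnection B q (A q)) = 2⁻¹ * koszul 𝓘(ℝ, E) A B C q := by
  rw [← inner_leviCivitaFun 𝓘(ℝ, E) hA hB hC, real_inner_comm, horizontalConnection]
  change inner ℝ ((S.fiber q).starProjection (leviCivitaFun 𝓘(ℝ, E) B q (A q))) (C q) = _
  rw [Submodule.inner_starProjection_left_eq_right, Submodule.starProjection_eq_self_iff.2 hCS]

/-- The Christoffel symbols of the horizontal connection in a frame, in the chart at `p`. -/
noncomputable def christoffel (S : HorizontalBundle 𝓘(ℝ, E) M k) (p : M)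
    (X : Fin k → Π x : M, TangentSpace 𝓘(ℝ, E) x) (i j : Fin k) (y : E) : Fin k → ℝ :=
  (gramOperator fun a => X a ((extChartAt 𝓘(ℝ, E) p).symm y)).inverse fun a =>
    inner ℝ (X a ((extChartAt 𝓘(ℝ, E) p).symm y))
      (S.horizontalConnection (X j) ((extChartAt 𝓘(ℝ, E) p).symm y)
        (X i ((extChartAt 𝓘(ℝ, E) p).symm y)))

theorem sum_christoffel_smul (hX : IsHorizontalFrameOn 𝓘(ℝ, E) S.fiber X U)
    (hxU : (extChartAt 𝓘(ℝ, E) p).symm x ∈ U) (i j : Fin k) :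
    ∑ l, S.christoffel p X i j x l • X l ((extChartAt 𝓘(ℝ, E) p).symm x) =
      S.horizontalConnection (X j) ((extChartAt 𝓘(ℝ, E) p).symm x)
        (X i ((extChartAt 𝓘(ℝ, E) p).symm x)) := by
  refine sum_gramOperator_inverse_smul (hX.linearIndependent _ hxU) ?_
  rw [hX.span_eq _ hxU]
  exact Submodule.starProjection_apply_mem _ _

theorem contDiffAt_christoffel (hX : IsHorizontalFrameOn 𝓘(ℝ, E) S.fiber X U) (hU : IsOpen U)
    (hx : x ∈ (extChartAt 𝓘(ℝ, E) p).target)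
    (hxU : (extChartAt 𝓘(ℝ, E) p).symm x ∈ U) (i j : Fin k) :
    ContDiffAt ℝ ∞ (S.christoffel p X i j) x := by
  have hXU : ∀ i, ∀ q ∈ U, CMDiffAt ∞ (T% (X i)) q := fun i q hq =>
    (hX.contMDiffOn i).contMDiffAt (hU.mem_nhds hq)
  have h1 : ContDiffAt ℝ ∞
      (fun y => gramOperator fun a => X a ((extChartAt 𝓘(ℝ, E) p).symm y)) x := by
    rw [← (ContinuousLinearEquiv.piRing (𝕜 := ℝ) (E := Fin k → ℝ) (Fin k)).comp_contDiffAt_iff]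
    refine contDiffAt_pi.2 fun η => contDiffAt_pi.2 fun a => ?_
    refine (ContDiffAt.sum (s := Finset.univ) fun b _ =>
      (contDiffAt_const (c := (Pi.single η 1 : Fin k → ℝ) b)).mul
      (contDiffAt_comp_chart_symm hx (contMDiffAt_inner (hXU a _ hxU) (hXU b _ hxU)))
      ).congr_of_eventuallyEq (Filter.Eventually.of_forall fun y =>
        gramOperator_apply_eq_sum (fun a => X a ((extChartAt 𝓘(ℝ, E) p).symm y))
          (Pi.single η 1) a)
  have h2 := (isInvertible_gramOperator
    (hX.linearIndependent _ hxU)).contDiffAt_map_inverse (n := ∞) |>.comp x h1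
  refine h2.clm_apply (contDiffAt_pi.2 fun a => ?_)
  refine (contDiffAt_const (c := (2⁻¹ : ℝ)).mul
    (contDiffAt_koszul_chart hx hU hxU (hXU i) (hXU j) (hXU a))).congr_of_eventuallyEq ?_
  filter_upwards [eventually_chart_symm_mem hx hU hxU] with y hy
  have hmd : ∀ i, MDiffAt (T% (X i)) ((extChartAt 𝓘(ℝ, E) p).symm y) := fun i =>
    (hXU i _ hy.2).mdifferentiableAt (by simp)
  refine inner_horizontalConnection (hmd i) (hmd j) (hmd a) ?_
  rw [← hX.span_eq _ hy.2]
  exact Submodule.subset_span ⟨a, rfl⟩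

theorem mdifferentiableAt_velocity_chart_symm_comp {c : ℝ → E} {t : ℝ} {c' : E}
    (ht : c t ∈ (extChartAt 𝓘(ℝ, E) p).target) (hc : HasDerivAt c c' t) :
    MDifferentiableAt 𝓘(ℝ, ℝ) 𝓘(ℝ, E) (fun s => (extChartAt 𝓘(ℝ, E) p).symm (c s)) t ∧
      velocity 𝓘(ℝ, E) (fun s => (extChartAt 𝓘(ℝ, E) p).symm (c s)) t =
        mfderiv 𝓘(ℝ, E) 𝓘(ℝ, E) (extChartAt 𝓘(ℝ, E) p).symm (c t) c' := by
  have h1 := ((contMDiffAt_chart_symm ht).mdifferentiableAt (by simp)).hasMFDerivAt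
  have h2 := h1.comp t hc.hasFDerivAt.hasMFDerivAt
  refine ⟨h2.mdifferentiableAt, ?_⟩
  have h3 := congrArg (fun T : ℝ →L[ℝ] E => T 1) h2.mfderiv
  refine h3.trans ?_
  exact congrArg (mfderiv 𝓘(ℝ, E) 𝓘(ℝ, E) (extChartAt 𝓘(ℝ, E) p).symm (c t))
    (one_smul ℝ c')

theorem sum_geodesic_eq_zero {V : Type*} [AddCommGroup V] [Module ℝ V] (y : Fin k → ℝ)
    (Γ : Fin k → Fin k → Fin k → ℝ) (e : Fin k → V) :
    ∑ l, (-∑ i, ∑ j, (y i * y j) • Γ i j) l • e l +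
      ∑ j, y j • ∑ i, y i • ∑ l, Γ i j l • e l = 0 := by
  have h : ∑ j, y j • ∑ i, y i • ∑ l, Γ i j l • e l =
      ∑ l, ∑ i, ∑ j, (y i * y j * Γ i j l) • e l := by
    simp only [Finset.smul_sum, smul_smul]
    rw [Finset.sum_comm]
    rw [Finset.sum_congr rfl fun i _ => Finset.sum_comm]
    rw [Finset.sum_comm]
    refine Finset.sum_congr rfl fun l _ => Finset.sum_congr rfl fun i _ =>
      Finset.sum_congr rfl fun j _ => ?_
    congr 1; ring
  rw [h]
  simp [Finset.sum_apply, Finset.sum_smul]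

/-- Solutions of the geodesic equations in a chart and a frame are nonholonomic geodesics. -/
theorem isNonholonomicGeodesicOn_of_hasDerivAt (hX : IsHorizontalFrameOn 𝓘(ℝ, E) S.fiber X U)
    (hU : IsOpen U) {J : Set ℝ} (hJ : IsOpen J) {c : ℝ → E} {y : ℝ → Fin k → ℝ}
    (hc : ∀ t ∈ J, c t ∈ (extChartAt 𝓘(ℝ, E) p).target)
    (hcU : ∀ t ∈ J, (extChartAt 𝓘(ℝ, E) p).symm (c t) ∈ U)
    (hc' : ∀ t ∈ J, HasDerivAt c (∑ j, y t j • chartField p (X j) (c t)) t)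
    (hy' : ∀ t ∈ J, HasDerivAt y (-∑ i, ∑ j, (y t i * y t j) • S.christoffel p X i j (c t)) t) :
    S.IsNonholonomicGeodesicOn (fun t => (extChartAt 𝓘(ℝ, E) p).symm (c t)) J := by
  have hvel : ∀ t ∈ J, velocity 𝓘(ℝ, E) (fun s => (extChartAt 𝓘(ℝ, E) p).symm (c s)) t =
      ∑ j, y t j • X j ((extChartAt 𝓘(ℝ, E) p).symm (c t)) := by
    intro t ht
    rw [(mdifferentiableAt_velocity_chart_symm_comp (hc t ht) (hc' t ht)).2]
    refine (map_sum (mfderiv 𝓘(ℝ, E) 𝓘(ℝ, E) (extChartAt 𝓘(ℝ, E) p).symm (c t)) _ _).trans ?_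
    refine Finset.sum_congr rfl fun j _ => ?_
    refine (map_smul (mfderiv 𝓘(ℝ, E) 𝓘(ℝ, E) (extChartAt 𝓘(ℝ, E) p).symm (c t)) _ _).trans ?_
    rw [mfderiv_chart_symm_chartField (hc t ht)]
  refine ⟨fun t ht => (mdifferentiableAt_velocity_chart_symm_comp (hc t ht) (hc' t ht)).1, fun t ht => ?_,
    fun t ht => ?_⟩
  · rw [hvel t ht, ← hX.span_eq _ (hcU t ht)]
    exact Submodule.sum_mem _ fun b _ => Submodule.smul_mem _ _ (Submodule.subset_span ⟨b, rfl⟩)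
  · refine ⟨U, X, fun j t => y t j, _, hU, hcU t ht, hX, ?_, hasDerivAt_pi.1 (hy' t ht), ?_⟩
    · filter_upwards [hJ.mem_nhds ht] with s hs using hvel s hs
    · rw [hvel t ht]
      simp only [map_sum, map_smul, ← sum_christoffel_smul hX (hcU t ht), Finset.sum_add_distrib]
      exact (sum_geodesic_eq_zero _ _ _).symm

end HorizontalBundle

namespace HorizontalBundle

variable [RiemannianBundle (fun x : M => TangentSpace 𝓘(ℝ, E) x)]
  [IsContMDiffRiemannianBundle 𝓘(ℝ, E) ∞ E (fun x : M => TangentSpace 𝓘(ℝ, E) x)]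
  {k : ℕ} {S : HorizontalBundle 𝓘(ℝ, E) M k}

theorem IsNConvex.eq_of_isNonholonomicGeodesicOn {f : M → ℝ} (hf : S.IsNConvex f)
    (hbdd : BddAbove (Set.range f)) (hS : S.IsNonholonomicallyComplete) {J : Set ℝ} (hJ : IsOpen J)
    (hJ' : J.OrdConnected) {γ : ℝ → M} (hγ : S.IsNonholonomicGeodesicOn γ J) {a b : ℝ}
    (ha : a ∈ J) (hb : b ∈ J) : f (γ a) = f (γ b) := by
  obtain ⟨η, hη, heq⟩ := hS J γ hJ hJ' hγ
  rw [← heq ha, ← heq hb]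
  exact eq_of_convexOn_of_bddAbove_range (hf _ η isOpen_univ Set.ordConnected_univ hη)
    (hbdd.mono (Set.range_comp_subset_range η f)) a b

/-- Every horizontal direction is the initial velocity of a twice differentiable family of
nonholonomic geodesics, with one geodesic issuing from every nearby point. -/
theorem exists_geodesic_flow {p : M} {x : E} (hx : x ∈ (extChartAt 𝓘(ℝ, E) p).target) {v : E}
    (hv : v ∈ S.chartFiber p x) :
    ∃ φ : ℝ × E → E, ContDiffAt ℝ 2 φ (0, x) ∧ (∀ᶠ y in 𝓝 x, φ (0, y) = y) ∧
      HasDerivAt (fun t => φ (t, x)) v 0 ∧ ∃ ε > 0, ∀ y ∈ Metric.ball x ε,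
        S.IsNonholonomicGeodesicOn (fun t => (extChartAt 𝓘(ℝ, E) p).symm (φ (t, y)))
          (Set.Ioo (-ε) ε) := by
  obtain ⟨U, X, hU, hxU, hX⟩ := S.exists_frame ((extChartAt 𝓘(ℝ, E) p).symm x)
  have hv' : mfderiv 𝓘(ℝ, E) 𝓘(ℝ, E) (extChartAt 𝓘(ℝ, E) p).symm x v ∈
    S.fiber ((extChartAt 𝓘(ℝ, E) p).symm x) := hv
  rw [← hX.span_eq _ hxU, Submodule.mem_span_range_iff_exists_fun] at hv'
  obtain ⟨y₀, hy₀⟩ := hv'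
  have hvy : ∑ j, y₀ j • chartField p (X j) x = v := by
    refine (isInvertible_mfderiv_chart_symm hx).bijective.injective ?_
    rw [← hy₀]
    refine (map_sum (mfderiv 𝓘(ℝ, E) 𝓘(ℝ, E) (extChartAt 𝓘(ℝ, E) p).symm x) _ _).trans ?_
    refine Finset.sum_congr rfl fun j _ => ?_
    refine (map_smul (mfderiv 𝓘(ℝ, E) 𝓘(ℝ, E) (extChartAt 𝓘(ℝ, E) p).symm x) _ _).trans ?_
    rw [mfderiv_chart_symm_chartField hx]
  let w : E × (Fin k → ℝ) → E × (Fin k → ℝ) := fun z =>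
    (∑ j, z.2 j • chartField p (X j) z.1,
      -∑ i, ∑ j, (z.2 i * z.2 j) • S.christoffel p X i j z.1)
  have hcoord : ∀ j, ContDiffAt ℝ ∞ (fun z : E × (Fin k → ℝ) => z.2 j) (x, y₀) := fun j =>
    contDiffAt_pi.1 contDiffAt_snd j
  have hw : ContDiffAt ℝ ∞ w (x, y₀) := by
    refine ContDiffAt.prodMk (ContDiffAt.sum fun j _ => (hcoord j).smul ?_)
      (ContDiffAt.sum fun i _ => ContDiffAt.sum fun j _ =>
        ((hcoord i).mul (hcoord j)).smul ?_).neg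
    · exact (contDiffAt_chartField hx
        ((hX.contMDiffOn j).contMDiffAt (hU.mem_nhds hxU))).comp (x, y₀) contDiffAt_fst
    · exact (contDiffAt_christoffel hX hU hx hxU i j).comp (x, y₀) contDiffAt_fst
  obtain ⟨w', hw', hww'⟩ := exists_contDiff_eventuallyEq (n := 2)
    (hw.of_le (by exact WithTop.coe_le_coe.2 (le_top : (2 : ℕ∞) ≤ ⊤)))
  obtain ⟨α, hα, hα0, hαd⟩ := exists_contDiffAt_flow two_ne_zero hw' (x, y₀)
  have hα00 : α (0, (x, y₀)) = (x, y₀) := hα0.self_of_nhds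
  have hιc : Continuous (fun y : E => (y, y₀)) := by fun_prop
  have hjc : ContDiff ℝ 2 (fun q : ℝ × E => (q.1, (q.2, y₀))) := by fun_prop
  have hgood : ∀ᶠ z in 𝓝 (x, y₀), w' z = w z ∧ z.1 ∈ (extChartAt 𝓘(ℝ, E) p).target ∧
      (extChartAt 𝓘(ℝ, E) p).symm z.1 ∈ U :=
    hww'.and ((continuous_fst.tendsto (x, y₀)).eventually (eventually_chart_symm_mem hx hU hxU))
  have hev : ∀ᶠ q in 𝓝 ((0 : ℝ), (x, y₀)),
      HasDerivAt (fun s => α (s, q.2)) (w (α q)) q.1 ∧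
      (α q).1 ∈ (extChartAt 𝓘(ℝ, E) p).target ∧ (extChartAt 𝓘(ℝ, E) p).symm (α q).1 ∈ U := by
    have h1 := hα.continuousAt.tendsto
    rw [hα00] at h1
    filter_upwards [hαd, h1.eventually hgood] with q h2 h3
    rw [← h3.1]
    exact ⟨h2, h3.2⟩
  refine ⟨fun q => (α (q.1, (q.2, y₀))).1, ?_, ?_, ?_, ?_⟩
  · exact contDiffAt_fst.comp (0, x) (ContDiffAt.comp (g := α) (0, x) hα hjc.contDiffAt)
  · filter_upwards [(hιc.tendsto x).eventually hα0] with y hy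
    simp [hy]
  · have h1 := hev.self_of_nhds.1
    rw [hα00] at h1
    have h2 := h1.hasFDerivAt.fst.hasDerivAt
    simpa [w, hvy] using h2
  · obtain ⟨ε, hε, h⟩ := Metric.eventually_nhds_iff_ball.1
      ((hjc.continuous.tendsto ((0 : ℝ), x)).eventually hev)
    refine ⟨ε, hε, fun y hy => ?_⟩
    have h' : ∀ t ∈ Set.Ioo (-ε) ε, (t, y) ∈ Metric.ball ((0 : ℝ), x) ε := fun t ht => by
      rw [← ball_prod_same]
      exact ⟨by simpa [abs_lt] using ht, hy⟩
    refine isNonholonomicGeodesicOn_of_hasDerivAt (c := fun t => (α (t, (y, y₀))).1)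
      (y := fun t => (α (t, (y, y₀))).2) hX hU isOpen_Ioo
      (fun t ht => (h _ (h' t ht)).2.1) (fun t ht => (h _ (h' t ht)).2.2) (fun t ht => ?_)
      (fun t ht => ?_)
    · have := (h _ (h' t ht)).1.hasFDerivAt.fst.hasDerivAt
      simpa [w] using this
    · have := (h _ (h' t ht)).1.hasFDerivAt.snd.hasDerivAt
      simpa [w] using this

theorem IsNConvex.eventually_eq {f : M → ℝ} (hf : S.IsNConvex f)
    (hbdd : BddAbove (Set.range f)) (hS : S.IsNonholonomicallyComplete)
    (hgen : ∀ p : M, ∃ l, S.flag l p = ⊤) (p : M) : ∀ᶠ q in 𝓝 p, f q = f p := by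
  have h := eventually_eq_of_flows (isOpen_extChartAt_target (I := 𝓘(ℝ, E)) p) (S.chartFiber p)
    (fun x => f ((extChartAt 𝓘(ℝ, E) p).symm x)) ?_ ?_ (mem_extChartAt_target (I := 𝓘(ℝ, E)) p)
  · rw [extChartAt_to_inv] at h
    filter_upwards [(continuousAt_extChartAt (I := 𝓘(ℝ, E)) p).eventually h,
      extChartAt_source_mem_nhds (I := 𝓘(ℝ, E)) p] with q h1 h2
    rwa [(extChartAt 𝓘(ℝ, E) p).left_inv h2] at h1
  · intro x hx v hv
    obtain ⟨φ, h1, h2, h3, ε, hε, h4⟩ := exists_geodesic_flow hx hv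
    refine ⟨φ, h1, h2, h3, ?_⟩
    have h5 : ∀ᶠ q : ℝ × E in 𝓝 (0, x), φ (0, q.2) = q.2 :=
      (continuous_snd.tendsto ((0 : ℝ), x)).eventually h2
    filter_upwards [h5, Metric.ball_mem_nhds ((0 : ℝ), x) hε] with q hq hqε
    rw [← ball_prod_same] at hqε
    have := hf.eq_of_isNonholonomicGeodesicOn hbdd hS isOpen_Ioo Set.ordConnected_Ioo
      (h4 q.2 hqε.2) (a := q.1) (b := 0) (by simpa [abs_lt] using hqε.1) (by simp [hε])
    simp only [hq] at this
    exact this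
  · intro V _ _ _ F u hF hinj hu htan
    obtain ⟨l, hl⟩ := hgen ((extChartAt 𝓘(ℝ, E) p).symm (F u))
    exact surjective_fderiv_of_tangent hF hinj hu htan hl

end HorizontalBundle

end SubRiem

theorem mainTheorem9 {m k : ℕ} {M : Type*} [TopologicalSpace M] [T2Space M]
    [SecondCountableTopology M] [ConnectedSpace M]
    [ChartedSpace (EuclideanSpace ℝ (Fin m)) M] [IsManifold (𝓡 m) ∞ M]
    [RiemannianBundle (fun x : M => TangentSpace (𝓡 m) x)]
    [IsContMDiffRiemannianBundle (𝓡 m) ∞ (EuclideanSpace ℝ (Fin m))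
      (fun x : M => TangentSpace (𝓡 m) x)]
    (S : SubRiem.HorizontalBundle (𝓡 m) M k)
    (hregular : S.IsRegular)
    (hcomplete : S.IsNonholonomicallyComplete)
    (f : M → ℝ) (hconvex : S.IsNConvex f) (hbdd : BddAbove (Set.range f)) :
    ∃ c : ℝ, ∀ x : M, f x = c := by
  have h : IsLocallyConstant f := (IsLocallyConstant.iff_eventually_eq f).2
    (hconvex.eventually_eq hbdd hcomplete fun p => (hregular p).imp fun l hl => hl.1)
  obtain ⟨x₀⟩ : Nonempty M := inferInstance
  exact ⟨f x₀, fun x => h.apply_eq_of_preconnectedSpace x x₀⟩
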